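/- **Corollary (Scaling invariance of reconstruction).** *Scanner.* Let $D\subset\mathcal D\subset\mathbb R^3$ be compact and convex, $D\neq\emptyset$, $\partial\mathcal D$ smooth and $\mathrm{dist}(D,\partial\mathcal D)\ge\delta>0$. Let $G\ge0$ be a smooth probability density with compact support in the open ball $B_{\delta/2}(0)$. Let $p^s,p^d>0$ with $p^s+p^d\le1$, and let $T,T_{1/2},\beta,q>0$. For $v\in S^2$ and $x\in D+B_{\delta/2}(0)$ let $R(x,v)=(a,b)$ with $\{a,b\}=\partial\mathcal D\cap(x+\mathbb Rv)$ and $(b-a)/|b-a|=v$. For nonnegative finite measures $\rho=dt\otimes\rho_t$ on $[0,T]\times D$ define $$A^s\rho=dt\otimes\tfrac{\rho_t(D)}{\mathcal H^2(\partial\mathcal D)^2}(\mathcal H^2\otimes\mathcal H^2)\llcorner(\partial\mathcal D\times\partial\mathcal D),\qquad A^d\rho=dt\otimes R_\#\big((G*\rho_t)\otimes\mathrm{vol}_{S^2}\big),$$ with $\mathrm{vol}_{S^2}$ the uniform probability measure on $S^2$, and set $A=p^sA^s+p^dA^d$, $A^q=qp^sA^s+p^dA^d$, $\nu=dt\otimes(\mathcal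 H^2\llcorner\partial\mathcal D)\otimes(\mathcal H^2\llcorner\partial\mathcal D)$ on $[0,T]\times\partial\mathcal D\times\partial\mathcal D$. Alternatively (discrete setting), let $\Gamma_1,\dots,\Gamma_M$ be a measurable partition of $\partial\mathcal D$ with $\mathcal H^2$-null relative boundaries, $z_j\in\Gamma_j$, $\tau_i=[(i-1)\frac TN,i\frac TN)$, $i=1,\dots,N$. Then $A,A^q$ are replaced by their compositions with $m\mapsto\sum_{i,j,k}m(\tau_i\times\Gamma_j\times\Gamma_k)\,\delta_{((i-1/2)T/N,\,z_j,\,z_k)}$, and $\nu=\sum_{i,j,k}\delta_{((i-1/2)T/N,\,z_j,\,z_k)}$; here $G\,dx$ may also be the Dirac measure $\delta_0$. *Reconstruction.* For $\rho\in\mathcal M_+([0,T]\times D)$ and $\eta\in\mathcal M([0,T]\times D)^3$ let $S(\rho,\eta)=\int|\frac{d\eta}{d\rho}|^2d\rho$ if $\rho=dt\otimes\rho_t$, $\eta\ll\rho$ and $\partial_t\rho+\mathrm{div}\,\eta=0$ in the distributional sense on $(0,T)\times\mathbb R^3$, and $S=\infty$ otherwise. For a measurement $E$ (a point measure on $[0,T]\times\partial\mathcal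 D\times\partial\mathcal D$, in the discrete setting on the atoms of $\nu$) let $$J^{E}(\rho,\eta)=\tfrac{\ln2}{T_{1/2}}\|A\rho\|-\int\log\Big(\tfrac{\ln2}{T_{1/2}}\tfrac{dA^q\rho}{d\nu}\Big)dE+\beta S(\rho,\eta)$$ ($J^E=\infty$ if $S=\infty$), where $\frac{dA^q\rho}{d\nu}$ is the continuous representative. Let $\mathrm{rec}(E)$ be the set of minimizers of $J^E$ over $\mathcal M_+([0,T]\times D)\times\mathcal M([0,T]\times D)^3$ if $|E|<\infty$, and $\mathrm{rec}(E)=\emptyset$ otherwise. Let $\rho^\dagger=dt\otimes\rho^\dagger_t\in\mathcal M_+([0,T]\times D)$, let $\boldsymbol E$ be a Poisson point process with intensity $\frac{\ln2}{T_{1/2}}A\rho^\dagger$, and let $\boldsymbol R=\mathrm{rec}(\boldsymbol E)$. Its law is considered on the Borel $\sigma$-algebra of the exponential (Vietoris) topology on the hyperspace of the state space, where the state space carries the weak-$*$ topology and $\emptyset$ is an isolated point of the hyperspace. *Claim.* Let $\theta,\lambda,\mu>0$, let $\bar s(t,x)=(t/\theta,x/\lambda)$ and $\bar S_{\theta,\lambda}m=\frac1\theta\bar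 s_\#m$ (for scalar and for vector measures), and set $$\hat\beta=\beta\mu\tfrac{\lambda^2}{\theta},\quad \hat T_{1/2}=\tfrac{T_{1/2}}{\mu\theta},\quad \hat T=\tfrac T\theta,\quad \hat D=\tfrac1\lambda D,\quad \hat\rho^\dagger=\tfrac1\mu\bar S_{\theta,\lambda}\rho^\dagger,$$ where the scanner is rescaled along with $D$: $\hat{\mathcal D}=\frac1\lambda\mathcal D$, $\hat G(x)=\lambda^3G(\lambda x)$ and, in the discrete setting, $\hat\Gamma_j=\frac1\lambda\Gamma_j$, $\hat z_j=\frac1\lambda z_j$ with the same number $N$ of time bins; $q,p^s,p^d$ are unchanged. Let $\hat{\boldsymbol R}$ be the stochastic reconstruction for the rescaled problem (that is, with all of these parameters and ground truth $\hat\rho^\dagger$). Then the law of $\hat{\boldsymbol R}$ equals the pushforward of the law of $\boldsymbol R$ under the map that sends a set of pairs $(\rho,\eta)$ to its image under $$(\rho,\eta)\mapsto\bar S_{\theta,\lambda}\big(\tfrac1\mu\rho,\tfrac\theta{\mu\lambda}\eta\big).$$ -/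

import Mathlib

open MeasureTheory Set
open scoped ENNReal NNReal Pointwise ContDiff

namespace PET

/-- Euclidean space `ℝ³`. -/
abbrev E3 := EuclideanSpace ℝ (Fin 3)

/-- Spacetime `ℝ × ℝ³`, with points `(t, x)`. -/
abbrev ST := ℝ × E3

/-- The space `ℝ × ℝ³ × ℝ³` of detection events `(t, a, b)`. -/
abbrev Ev := ℝ × E3 × E3

/-- The unit sphere `S²`. -/
abbrev S2 := Metric.sphere (0 : E3) 1

noncomputable section

/-- The normalized uniform measure on `S²`. -/
def volS2 : Measure S2 :=
  ((volume : Measure E3).toSphere univ)⁻¹ • (volume : Measure E3).toSphere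

/-- The two-dimensional Hausdorff measure on `ℝ³`, with the usual normalization `π / 4`
(so that it is the area on planes; Mathlib's `μH[2]` has no normalizing constant). -/
def hausdorff2 : Measure E3 := ENNReal.ofReal (Real.pi / 4) • Measure.hausdorffMeasure 2

/-- The surface measure `H² ⌞ ∂K`. -/
def surface (K : Set E3) : Measure E3 := hausdorff2.restrict (frontier K)

/-- `K` is locally the sublevel set of a smooth function with non-vanishing differential. -/
def HasSmoothBoundary (K : Set E3) : Prop :=
  ∀ x ∈ frontier K, ∃ (U : Set E3) (φ : E3 → ℝ), IsOpen U ∧ x ∈ U ∧ ContDiff ℝ ∞ φ ∧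
    fderiv ℝ φ x ≠ 0 ∧ K ∩ U = {y ∈ U | φ y ≤ 0}

/-! ### Scanner -/

/-- Data of a discrete measurement: `numBins` time bins of equal length and finitely many photon
detectors `det j` on the boundary, each represented by one of its points `pt j`. -/
structure Binning where
  numBins : ℕ
  numDet : ℕ
  det : Fin numDet → Set E3
  pt : Fin numDet → E3

/-- The data of a PET scanner. `binning = none` is the continuous (nondiscrete) setting,
`binning = some b` the discrete one. -/
structure Scanner where
  /-- The measurement volume `D`. -/
  dom : Set E3
  /-- The convex set `𝒟` on whose boundary the photon pairs are detected. -/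
  body : Set E3
  /-- The distance between `D` and `∂𝒟` (lower bound). -/
  gap : ℝ
  /-- The law of the annihilation location of a positron emitted at the origin
  (`G(x) dx` for a kernel `G`; a Dirac mass for vanishing positron range). -/
  range : Measure E3
  /-- The probability of scattering. -/
  pS : ℝ
  /-- The probability of scatterless detection. -/
  pD : ℝ
  binning : Option Binning

/-- `γ` has a smooth probability density compactly supported in the open ball of radius `r`. -/
def HasSmoothKernel (γ : Measure E3) (r : ℝ) : Prop :=
  ∃ G : E3 → ℝ, ContDiff ℝ ∞ G ∧ (∀ x, 0 ≤ G x) ∧ tsupport G ⊆ Metric.ball 0 r ∧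
    ∫ x, G x = 1 ∧ γ = volume.withDensity fun x => ENNReal.ofReal (G x)

/-- The detectors are a measurable partition of `∂K`, have `H²`-null relative boundary in `∂K`,
and contain their representing points. -/
structure Binning.Admissible (b : Binning) (K : Set E3) : Prop where
  numBins_pos : 0 < b.numBins
  measurable : ∀ j, MeasurableSet (b.det j)
  disjoint : Pairwise fun j k => Disjoint (b.det j) (b.det k)
  cover : ⋃ j, b.det j = frontier K
  boundary_null : ∀ j, hausdorff2 (closure (b.det j) ∩ closure (frontier K \ b.det j)) = 0
  pt_mem : ∀ j, b.pt j ∈ b.det j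

/-- The standing assumptions on the scanning geometry. Vanishing positron range is allowed in the
discrete setting only. -/
structure Scanner.Admissible (C : Scanner) : Prop where
  dom_nonempty : C.dom.Nonempty
  dom_compact : IsCompact C.dom
  dom_convex : Convex ℝ C.dom
  body_compact : IsCompact C.body
  body_convex : Convex ℝ C.body
  body_smooth : HasSmoothBoundary C.body
  dom_subset : C.dom ⊆ C.body
  gap_pos : 0 < C.gap
  gap_le : ∀ x ∈ C.dom, ∀ y ∈ frontier C.body, C.gap ≤ dist x y
  kernel : HasSmoothKernel C.range (C.gap / 2) ∨
    (C.binning.isSome ∧ C.range = Measure.dirac 0)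
  pS_pos : 0 < C.pS
  pD_pos : 0 < C.pD
  prob_le : C.pS + C.pD ≤ 1
  binning_adm : ∀ b ∈ C.binning, b.Admissible C.body

/-- The discrete measurement data in the length unit `l`. -/
def Binning.scale (b : Binning) (l : ℝ) : Binning where
  numBins := b.numBins
  numDet := b.numDet
  det j := l⁻¹ • b.det j
  pt j := l⁻¹ • b.pt j

/-- The same scanner with all lengths measured in the length unit `l`: `D`, `𝒟`, `∂𝒟`, the gap,
the detectors and the positron range are shrunk by the factor `1 / l`. (For `range = G(x) dx` the
scaled kernel is `l³ G(l x)`.) -/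
def Scanner.scale (C : Scanner) (l : ℝ) : Scanner where
  dom := l⁻¹ • C.dom
  body := l⁻¹ • C.body
  gap := C.gap / l
  range := C.range.map fun x => l⁻¹ • x
  pS := C.pS
  pD := C.pD
  binning := C.binning.map fun b => b.scale l

/-! ### Forward operator

For `ρ = dt ⊗ ρ_t`, each operator below acts on the time slices `ρ_t`, carrying the time variable
along. -/

/-- Positron range: `dt ⊗ ρ_t ↦ dt ⊗ (G * ρ_t)`. -/
def positronRange (γ : Measure E3) (ρ : Measure ST) : Measure ST :=
  (ρ.prod γ).map fun p => (p.1.1, p.1.2 + p.2)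

/-- Emission directions: `dt ⊗ ρ_t ↦ dt ⊗ ρ_t ⊗ vol_{S²}`. -/
def lines (ρ : Measure ST) : Measure (ST × S2) := ρ.prod volS2

/-- The two points `(a, b)` in which the line `x + ℝ v` meets `∂K`, ordered such that `b - a` points
in direction `v` (for convex compact `K`, `x` an interior point of `K`). -/
def hit (K : Set E3) (x v : E3) : E3 × E3 :=
  (x + sInf {r : ℝ | x + r • v ∈ frontier K} • v, x + sSup {r : ℝ | x + r • v ∈ frontier K} • v)

/-- Detection on `∂K`: the pushforward under `(t, x, v) ↦ (t, R(x, v))`. -/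
def detectors (K : Set E3) (m : Measure (ST × S2)) : Measure Ev :=
  m.map fun p => (p.1.1, hit K p.1.2 (p.2 : E3))

/-- The operator `A^d` of scatterless detection. -/
def detectOp (C : Scanner) (ρ : Measure ST) : Measure Ev :=
  detectors C.body (lines (positronRange C.range ρ))

/-- The scatter operator `A^s`:
`dt ⊗ ρ_t ↦ dt ⊗ (ρ_t(D) / H²(∂𝒟)²) (H² ⊗ H²) ⌞ (∂𝒟 × ∂𝒟)`. -/
def scatterOp (C : Scanner) (ρ : Measure ST) : Measure Ev :=
  (surface C.body univ ^ 2)⁻¹ •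
    (ρ.map Prod.fst).prod ((surface C.body).prod (surface C.body))

/-- `A^q = q p^s A^s + p^d A^d` in the nondiscrete setting. -/
def forwardCont (C : Scanner) (q : ℝ) (ρ : Measure ST) : Measure Ev :=
  ENNReal.ofReal (q * C.pS) • scatterOp C ρ + ENNReal.ofReal C.pD • detectOp C ρ

/-- The `i`-th time bin `[i ΔT, (i + 1) ΔT)`, `ΔT = T / numBins`, with `i` starting at `0`. -/
def Binning.bin (b : Binning) (T : ℝ) (i : Fin b.numBins) : Set ℝ :=
  Ico ((i : ℝ) * (T / b.numBins)) (((i : ℝ) + 1) * (T / b.numBins))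

/-- The discrete detection event at the centre of the `i`-th time bin in the detector pair
`(j, k)`. -/
def Binning.node (b : Binning) (T : ℝ) (i : Fin b.numBins) (j k : Fin b.numDet) : Ev :=
  (((i : ℝ) + 1 / 2) * (T / b.numBins), b.pt j, b.pt k)

/-- The discretization operator. -/
def Binning.discretize (b : Binning) (T : ℝ) (m : Measure Ev) : Measure Ev :=
  ∑ i, ∑ j, ∑ k, m (b.bin T i ×ˢ b.det j ×ˢ b.det k) • Measure.dirac (b.node T i j k)

/-- The operator `A^q` on spacetime measures, in the continuous or in the discrete setting. -/
def forwardQ (C : Scanner) (T q : ℝ) (ρ : Measure ST) : Measure Ev :=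
  match C.binning with
  | none => forwardCont C q ρ
  | some b => b.discretize T (forwardCont C q ρ)

/-- The forward operator `A = p^s A^s + p^d A^d` (attenuated photon pairs contribute zero). -/
def forward (C : Scanner) (T : ℝ) (ρ : Measure ST) : Measure Ev := forwardQ C T 1 ρ

/-- The reference measure `ν`: `dt ⊗ (H² ⌞ ∂𝒟) ⊗ (H² ⌞ ∂𝒟)` on `[0,T] × ∂𝒟 × ∂𝒟` in the
continuous setting, the counting measure on the discrete detection events in the discrete one. -/
def refMeasure (C : Scanner) (T : ℝ) : Measure Ev :=
  match C.binning with
  | none => (volume.restrict (Icc 0 T)).prod ((surface C.body).prod (surface C.body))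
  | some b => ∑ i, ∑ j, ∑ k, Measure.dirac (b.node T i j k)

/-- The set of possible detection events: `[0,T] × ∂𝒟 × ∂𝒟` in the continuous setting, the finite
set of discrete detection events in the discrete one. -/
def eventSet (C : Scanner) (T : ℝ) : Set Ev :=
  match C.binning with
  | none => Icc 0 T ×ˢ frontier C.body ×ˢ frontier C.body
  | some b => {z | ∃ i j k, z = b.node T i j k}

/-- `f` is the continuous representative of the Radon-Nikodym derivative `d(A^q ρ)/dν`.
(The derivative has to be evaluated in the points of a measurement, so it is not enough to know it
almost everywhere. As `ν` has full support in the event set, the values of `f` there are unique.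
In the discrete setting continuity on the finite event set is no restriction.) -/
def IsDensity (C : Scanner) (T q : ℝ) (ρ : Measure ST) (f : Ev → ℝ≥0) : Prop :=
  ContinuousOn f (eventSet C T) ∧
    forwardQ C T q ρ = (refMeasure C T).withDensity fun z => (f z : ℝ≥0∞)

/-! ### State space, Benamou-Brenier functional -/

/-- Pairs `(ρ, η)` of a nonnegative finite measure and an `ℝ³`-valued measure on spacetime. -/
@[ext]
structure State where
  rho : FiniteMeasure ST
  eta : VectorMeasure ST E3

open ContinuousLinearMap in
/-- The topology of convergence of the integrals of all bounded continuous functions. On the pairs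
carried by a fixed compact set this is the weak-* topology of the space of Radon measures on that
set. -/
instance : TopologicalSpace State :=
  TopologicalSpace.induced
    (fun y (f : BoundedContinuousFunction ST ℝ) =>
      (∫ z, f z ∂(y.rho : Measure ST), y.eta.integral (fun z => f z) (lsmul ℝ ℝ)))
    inferInstance

/-- The set `M₊([0,T] × D) × M([0,T] × D)³`. -/
def stateSet (D : Set E3) (T : ℝ) : Set State :=
  {y | (y.rho : Measure ST) (Icc 0 T ×ˢ D)ᶜ = 0 ∧
    ∀ B, MeasurableSet B → Disjoint B (Icc 0 T ×ˢ D) → y.eta B = 0}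

/-- `ρ` has the form `dt ⊗ ρ_t`, that is, its time marginal is absolutely continuous with respect to
the Lebesgue measure. -/
def HasTimeSlices (ρ : Measure ST) : Prop := ρ.map Prod.fst ≪ volume

/-- The continuity equation `∂_t ρ + div η = 0` on `(0,T) × ℝ³` in the distributional sense. -/
def ContinuityEq (T : ℝ) (y : State) : Prop :=
  ∀ φ : ST → ℝ, ContDiff ℝ ∞ φ → HasCompactSupport φ → tsupport φ ⊆ Ioo 0 T ×ˢ univ →
    ∫ z, fderiv ℝ φ z (1, 0) ∂(y.rho : Measure ST) +
      y.eta.integral (fun z => (fderiv ℝ φ z).comp (ContinuousLinearMap.inr ℝ ℝ E3))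
        (ContinuousLinearMap.id ℝ (E3 →L[ℝ] ℝ)) = 0

/-- The Benamou-Brenier functional: `∫ |v|² dρ` if `ρ = dt ⊗ ρ_t`, the continuity equation holds,
and `η = v ρ` (`v = dη/dρ` is then unique `ρ`-a.e.); `∞` otherwise. -/
def benamouBrenier (T : ℝ) (y : State) : ℝ≥0∞ :=
  ⨅ (_ : HasTimeSlices (y.rho : Measure ST)) (_ : ContinuityEq T y) (v : ST → E3)
    (_ : Integrable v (y.rho : Measure ST))
    (_ : y.eta = (y.rho : Measure ST).withDensityᵥ v),
    ∫⁻ z, ‖v z‖ₑ ^ 2 ∂(y.rho : Measure ST)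

/-! ### Reconstruction functional -/

/-- `- ∫_Z log g dE` with `log 0 = -∞`, as a difference of integrals of positive and negative
parts. -/
def negLogIntegral (Z : Set Ev) (E : Measure Ev) (g : Ev → ℝ≥0∞) : EReal :=
  ((∫⁻ z in Z, (-(ENNReal.log (g z))).toENNReal ∂E : ℝ≥0∞) : EReal) -
    ((∫⁻ z in Z, (ENNReal.log (g z)).toENNReal ∂E : ℝ≥0∞) : EReal)

/-- The decay rate `ln 2 / τ` of a radionuclide of half-life `τ`. -/
def decayRate (τ : ℝ) : ℝ≥0∞ := ENNReal.ofReal (Real.log 2 / τ)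

/-- The reconstruction functional
`J(ρ, η) = (ln 2/τ) ‖A ρ‖ - ∫ log ((ln 2/τ) d(A^q ρ)/dν) dE + β S(ρ, η)`, where `τ` is the
half-life. The infimum runs over the continuous representative of `d(A^q ρ)/dν` (unique on the event
set); `J = ∞` if there is none, and `J = ∞` if `S(ρ, η) = ∞`. -/
def functional (C : Scanner) (q β τ T : ℝ) (E : Measure Ev) (y : State) : EReal :=
  ⨅ (f : Ev → ℝ≥0) (_ : IsDensity C T q (y.rho : Measure ST) f),
    ((decayRate τ * forward C T (y.rho : Measure ST) univ : ℝ≥0∞) : EReal) +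
      negLogIntegral (eventSet C T) E (fun z => decayRate τ * (f z : ℝ≥0∞)) +
      ((ENNReal.ofReal β * benamouBrenier T y : ℝ≥0∞) : EReal)

/-! ### Point processes -/

/-- The space `N` of point measures: countable sums of `ℕ`-valued measures. -/
def PointMeasure (Z : Type*) [MeasurableSpace Z] :=
  {E : Measure Z // ∃ m : ℕ → Measure Z,
    (∀ n B, MeasurableSet B → ∃ k : ℕ, m n B = k) ∧ E = Measure.sum m}

/-- The σ-algebra on `N` generated by the evaluations `E ↦ E(B)`. -/
instance (Z : Type*) [MeasurableSpace Z] : MeasurableSpace (PointMeasure Z) :=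
  MeasurableSpace.comap Subtype.val inferInstance

/-- `X` is a Poisson point process with intensity `Λ`. -/
structure IsPoissonProcess {Ω Z : Type*} [MeasurableSpace Ω] [MeasurableSpace Z]
    (X : Ω → PointMeasure Z) (Λ : Measure Z) (P : Measure Ω) : Prop where
  measurable : Measurable X
  count : ∀ B, MeasurableSet B → Λ B ≠ ⊤ → ∀ k : ℕ,
    P {w | (X w).1 B = k} = ProbabilityTheory.poissonMeasure (Λ B).toNNReal {k}
  count_top : ∀ B, MeasurableSet B → Λ B = ⊤ → ∀ᵐ w ∂P, (X w).1 B = ⊤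
  indep : ∀ (n : ℕ) (B : Fin n → Set Z), (∀ i, MeasurableSet (B i)) →
    (Pairwise fun i j => Disjoint (B i) (B j)) →
    ProbabilityTheory.iIndepFun (fun i w => (X w).1 (B i)) P

/-- The intensity `(ln 2/τ) A ρ†` of the measurement for the ground truth `ρ†`. -/
def intensity (C : Scanner) (τ T : ℝ) (ρ : Measure ST) : Measure Ev :=
  decayRate τ • forward C T ρ

/-! ### Reconstruction map -/

/-- The hyperspace of subsets of a topological space. -/
@[ext]
structure Hyperspace (Y : Type*) where
  carrier : Set Y

/-- The exponential (Vietoris) topology. On the closed subsets it induces the exponential topology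
in which the empty set is an isolated point. -/
instance (Y : Type*) [TopologicalSpace Y] : TopologicalSpace (Hyperspace Y) :=
  TopologicalSpace.induced Hyperspace.carrier (TopologicalSpace.vietoris Y)

instance (Y : Type*) [TopologicalSpace Y] : MeasurableSpace (Hyperspace Y) := borel _

/-- The image of a set under a map, as a map of hyperspaces. -/
def Hyperspace.image {Y Y' : Type*} (g : Y → Y') (S : Hyperspace Y) : Hyperspace Y' :=
  ⟨g '' S.carrier⟩

/-- The set-valued reconstruction: the set of minimizers of the functional over
`M₊([0,T] × D) × M([0,T] × D)³` if `|E| < ∞`, and the empty set otherwise. -/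
def reconstruction (C : Scanner) (q β τ T : ℝ) (E : PointMeasure Ev) : Hyperspace State :=
  ⟨{y | E.1 univ < ⊤ ∧ y ∈ stateSet C.dom T ∧
    ∀ y' ∈ stateSet C.dom T, functional C q β τ T E.1 y ≤ functional C q β τ T E.1 y'}⟩

/-! ### Spacetime rescaling -/

/-- The coordinate change `(t, x) ↦ (t/θ, x/l)`. -/
def sBar (θ l : ℝ) (z : ST) : ST := (z.1 / θ, l⁻¹ • z.2)

/-- The operator `S̄_{θ,l} = (1/θ) (s̄_{θ,l})_#` on nonnegative measures. -/
def SBar (θ l : ℝ) (ρ : FiniteMeasure ST) : FiniteMeasure ST :=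
  (1 / θ).toNNReal • ρ.map (sBar θ l)

/-- The operator `S̄_{θ,l} = (1/θ) (s̄_{θ,l})_#` on `ℝ³`-valued measures. -/
def SBarVec (θ l : ℝ) (η : VectorMeasure ST E3) : VectorMeasure ST E3 :=
  (1 / θ) • η.map (sBar θ l)

/-- The rescaled ground truth `(1/μ) S̄_{θ,l} ρ†`. -/
def rescaleTruth (θ l μ : ℝ) (ρ : FiniteMeasure ST) : FiniteMeasure ST :=
  (1 / μ).toNNReal • SBar θ l ρ

/-- The rescaling `(ρ, η) ↦ S̄_{θ,l}((1/μ) ρ, (θ/(μ l)) η)` of reconstructions. -/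
def State.rescale (θ l μ : ℝ) (y : State) : State where
  rho := SBar θ l ((1 / μ).toNNReal • y.rho)
  eta := SBarVec θ l ((θ / (μ * l)) • y.eta)

end

end PET

namespace PET

/-! ### Push-forward under measurable equivalences, without measurability of the other map -/

section MapEquiv

variable {α β γ δ : Type*} [MeasurableSpace α] [MeasurableSpace β] [MeasurableSpace γ]
  [MeasurableSpace δ]

/-! The proof is a change of variables at the level of events, states and sets of states.

Let `e = evEquiv` be the dilation of events. Every part of the forward operator commutes with
dilations, so rescaled states give the rescaled forward measure with factor `1/(μθ)`
(`forwardQ_scale`). The new decay rate contributes `μθ`, so the intensity becomes exactly its image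
under `e`. A Poisson law is determined by its intensity (`IsPoissonProcess.map_eq`), so the rescaled
measurement has the law of `e` applied to the original one.

For a finite measurement `E`, the rescaled functional for `e_# E` at the rescaled state equals the
original functional plus a finite constant independent of the state (`exists_functional_rescale`).
The mass term is invariant, and the factor `θ/(l²μ)` gained by the Benamou-Brenier term is absorbed
by the new `β`. The density changes by a constant factor, so its logarithm only produces a shift.
Hence minimizers correspond (`reconstruction_scale`).

Rescaling is a homeomorphism of states, so it induces a Borel isomorphism of hyperspaces and the
laws can be compared. Measurability of the reconstruction map is never needed: `Measure.map` is zero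
for a map that is not a.e. measurable, and composition with a measurable equivalence does not affect
a.e. measurability. -/

theorem map_map_equiv_left (e : α ≃ᵐ β) (g : β → γ) (μ : Measure α) :
    (μ.map e).map g = μ.map (g ∘ e) := by
  by_cases h : AEMeasurable g (μ.map e)
  · exact AEMeasurable.map_map_of_aemeasurable h e.measurable.aemeasurable
  · rw [Measure.map_of_not_aemeasurable h, Measure.map_of_not_aemeasurable]
    rwa [e.measurableEmbedding.aemeasurable_map_iff] at h

theorem map_map_equiv_right (e : β ≃ᵐ γ) (g : α → β) (μ : Measure α) :
    (μ.map g).map e = μ.map (e ∘ g) := by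
  by_cases h : AEMeasurable g μ
  · exact AEMeasurable.map_map_of_aemeasurable e.measurable.aemeasurable h
  · rw [Measure.map_of_not_aemeasurable h, Measure.map_zero, Measure.map_of_not_aemeasurable]
    rwa [e.measurableEmbedding.aemeasurable_comp_iff]

theorem map_map_equiv_conj (e : α ≃ᵐ β) (e' : γ ≃ᵐ δ) {g : α → γ} {g' : β → δ}
    (h : ∀ a, g' (e a) = e' (g a)) (μ : Measure α) :
    (μ.map e).map g' = (μ.map g).map e' := by
  rw [map_map_equiv_left, map_map_equiv_right]
  congr 1
  exact funext h

/-- Push-forward under a measurable equivalence, as a measurable equivalence of measures. -/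
noncomputable def mapMeasureEquiv (e : α ≃ᵐ β) : Measure α ≃ᵐ Measure β where
  toFun := Measure.map e
  invFun := Measure.map e.symm
  left_inv μ := by simp
  right_inv μ := by simp
  measurable_toFun := Measure.measurable_map _ e.measurable
  measurable_invFun := Measure.measurable_map _ e.symm.measurable

theorem measurable_smul_measure (c : ℝ≥0∞) : Measurable fun μ : Measure α => c • μ := by
  refine Measure.measurable_of_measurable_coe _ fun s hs => ?_
  simp only [Measure.smul_apply, smul_eq_mul]
  exact (Measure.measurable_coe hs).const_mul c

theorem inv_smul_smul_measure {c : ℝ≥0∞} (h0 : c ≠ 0) (ht : c ≠ ⊤) (μ : Measure α) :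
    c⁻¹ • c • μ = μ := by
  rw [smul_smul, ENNReal.inv_mul_cancel h0 ht, one_smul]

/-- Multiplication by a positive finite scalar, as a measurable equivalence of measures. -/
noncomputable def smulMeasureEquiv {c : ℝ≥0∞} (h0 : c ≠ 0) (ht : c ≠ ⊤) : Measure α ≃ᵐ Measure α where
  toFun μ := c • μ
  invFun μ := c⁻¹ • μ
  left_inv μ := inv_smul_smul_measure h0 ht μ
  right_inv μ := by
    simpa using inv_smul_smul_measure (ENNReal.inv_ne_zero.2 ht) (ENNReal.inv_ne_top.2 h0) μ
  measurable_toFun := measurable_smul_measure c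
  measurable_invFun := measurable_smul_measure c⁻¹

theorem join_map_smul (c : ℝ≥0∞) (M : Measure (Measure α)) :
    (M.map fun μ => c • μ).join = c • M.join := by
  ext s hs
  rw [Measure.smul_apply, Measure.join_apply hs, Measure.join_apply hs,
    lintegral_map (Measure.measurable_coe hs) (measurable_smul_measure c)]
  simp only [Measure.smul_apply, smul_eq_mul]
  exact lintegral_const_mul _ (Measure.measurable_coe hs)

/-- No s-finiteness is assumed (surface measures are not shown to have it), so the section map `x ↦
ν.map (Prod.mk x)` may fail to be measurable. Unfolding the product to a `join` of a push-forward
makes both sides degenerate together in that case. -/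
theorem prod_map_equiv (e : α ≃ᵐ β) (f : γ ≃ᵐ δ) (μ : Measure α) (ν : Measure γ) :
    (μ.map e).prod (ν.map f) = (μ.prod ν).map (e.prodCongr f) := by
  rw [Measure.prod_def, Measure.prod_def, Measure.bind, Measure.bind, map_map_equiv_left,
    ← Measure.join_map_map (e.prodCongr f).measurable]
  congr 1
  rw [show Measure.map (e.prodCongr f) = mapMeasureEquiv (e.prodCongr f) from rfl,
    map_map_equiv_right]
  congr 1
  funext x
  simp only [Function.comp_apply]
  rw [show mapMeasureEquiv (e.prodCongr f) (ν.map (Prod.mk x)) =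
    (ν.map (Prod.mk x)).map (e.prodCongr f) from rfl]
  rw [Measure.map_map measurable_prodMk_left f.measurable,
    Measure.map_map (e.prodCongr f).measurable measurable_prodMk_left]
  rfl

theorem smul_measure_prod (c : ℝ≥0∞) (μ : Measure α) (ν : Measure β) :
    (c • μ).prod ν = c • μ.prod ν := by
  rw [Measure.prod_def, Measure.prod_def, Measure.bind_smul]

/-- An invertible scalar acts on measures as a measurable equivalence, so it does not change whether
the section map is measurable. -/
theorem measure_prod_smul {c : ℝ≥0∞} (h0 : c ≠ 0) (ht : c ≠ ⊤) (μ : Measure α) (ν : Measure β) :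
    μ.prod (c • ν) = c • μ.prod ν := by
  rw [Measure.prod_def, Measure.prod_def, Measure.bind, Measure.bind, ← join_map_smul]
  congr 1
  rw [show (fun μ : Measure (α × β) => c • μ) = smulMeasureEquiv h0 ht from rfl,
    map_map_equiv_right]
  congr 1
  funext x
  simp [smulMeasureEquiv]

theorem map_withDensity_equiv (e : α ≃ᵐ β) (μ : Measure α) (f : β → ℝ≥0∞) :
    (μ.map e).withDensity f = (μ.withDensity (f ∘ e)).map e := by
  ext s hs
  rw [withDensity_apply _ hs, e.map_apply, withDensity_apply _ (e.measurable hs), e.restrict_map,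
    lintegral_map_equiv]
  rfl

end MapEquiv

/-! ### The law of a Poisson process -/

section Poisson

/-- The atoms at the naturals already carry mass one, so `μ` dominates the image of `ν` and equal
total mass forces equality. This turns the point probabilities of a Poisson count into its whole law
on `ℝ≥0∞`. -/
theorem eq_map_natCast {μ : Measure ℝ≥0∞} {ν : Measure ℕ} [IsProbabilityMeasure μ]
    [IsProbabilityMeasure ν] (h : ∀ k : ℕ, μ {(k : ℝ≥0∞)} = ν {k}) : μ = ν.map Nat.cast := by
  have hc : Measurable (Nat.cast : ℕ → ℝ≥0∞) := measurable_from_top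
  have : IsProbabilityMeasure (ν.map (Nat.cast : ℕ → ℝ≥0∞)) :=
    Measure.isProbabilityMeasure_map hc.aemeasurable
  refine (Measure.eq_of_le_of_measure_univ_eq (Measure.le_iff.2 fun s hs => ?_) (by simp)).symm
  rw [Measure.map_apply hc hs]
  set S : Set ℕ := Nat.cast ⁻¹' s
  calc ν S = ν (⋃ k ∈ S, {k}) := by simp
    _ = ∑' k : S, ν {(k : ℕ)} := measure_biUnion (to_countable S)
        (fun i _ j _ hij => by simpa using hij) fun _ _ => measurableSet_singleton _
    _ = ∑' k : S, μ {((k : ℕ) : ℝ≥0∞)} := by simp only [h]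
    _ = μ (⋃ k ∈ S, {((k : ℕ) : ℝ≥0∞)}) := (measure_biUnion (to_countable S)
        (fun i _ j _ hij => by simpa using hij) fun _ _ => measurableSet_singleton _).symm
    _ ≤ μ s := measure_mono (by
        intro x hx
        simp only [mem_iUnion, mem_singleton_iff] at hx
        obtain ⟨k, hk, rfl⟩ := hx
        exact hk)

variable {Ω Ω' Z Z' : Type*} [MeasurableSpace Ω] [MeasurableSpace Ω'] [MeasurableSpace Z]
  [MeasurableSpace Z']

theorem measurable_count {B : Set Z} (hB : MeasurableSet B) :
    Measurable fun E : PointMeasure Z => E.1 B :=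
  (Measure.measurable_coe hB).comp (comap_measurable _)

/-- The count of a Poisson process in a set has the law determined by the intensity. -/
theorem IsPoissonProcess.map_count_eq {X : Ω → PointMeasure Z} {X' : Ω' → PointMeasure Z}
    {Λ : Measure Z} {P : Measure Ω} {P' : Measure Ω'} [IsProbabilityMeasure P]
    [IsProbabilityMeasure P'] (h : IsPoissonProcess X Λ P) (h' : IsPoissonProcess X' Λ P')
    {B : Set Z} (hB : MeasurableSet B) :
    P.map (fun w => (X w).1 B) = P'.map fun w => (X' w).1 B := by
  have hm : Measurable fun w => (X w).1 B := (measurable_count hB).comp h.measurable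
  have hm' : Measurable fun w => (X' w).1 B := (measurable_count hB).comp h'.measurable
  by_cases hΛ : Λ B = ⊤
  · rw [Measure.map_congr (h.count_top B hB hΛ), Measure.map_congr (h'.count_top B hB hΛ)]
    simp [Measure.map_const]
  · have := Measure.isProbabilityMeasure_map (μ := P) hm.aemeasurable
    have := Measure.isProbabilityMeasure_map (μ := P') hm'.aemeasurable
    rw [eq_map_natCast (μ := P.map fun w => (X w).1 B)
      (ν := ProbabilityTheory.poissonMeasure (Λ B).toNNReal) fun k => ?_,
      eq_map_natCast (μ := P'.map fun w => (X' w).1 B)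
      (ν := ProbabilityTheory.poissonMeasure (Λ B).toNNReal) fun k => ?_]
    · rw [Measure.map_apply hm' (measurableSet_singleton _), ← h'.count B hB hΛ k]
      rfl
    · rw [Measure.map_apply hm (measurableSet_singleton _), ← h.count B hB hΛ k]
      rfl

theorem IsPoissonProcess.map_counts_disjoint {X : Ω → PointMeasure Z} {Λ : Measure Z}
    {P : Measure Ω} [IsProbabilityMeasure P] (h : IsPoissonProcess X Λ P) {ι : Type*} [Fintype ι]
    {C : ι → Set Z} (hC : ∀ i, MeasurableSet (C i))
    (hd : Pairwise fun i j => Disjoint (C i) (C j)) :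
    P.map (fun w i => (X w).1 (C i)) = Measure.pi fun i => P.map fun w => (X w).1 (C i) := by
  refine (ProbabilityTheory.iIndepFun_iff_map_fun_eq_pi_map (f := fun i w => (X w).1 (C i))
    fun i => ((measurable_count (hC i)).comp h.measurable).aemeasurable).1 ?_
  -- Independence is postulated for families indexed by `Fin n` and is transported along an
  -- enumeration.
  let e := (Fintype.equivFin ι).symm
  have := h.indep _ (fun j => C (e j)) (fun j => hC _) fun i j hij => hd (e.injective.ne hij)
  exact (ProbabilityTheory.iIndepFun_precomp_of_bijective
    (f := fun i w => (X w).1 (C i)) e.bijective).1 this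

/-- The set of points that lie in exactly those `B i` with `i ∈ A`. -/
def partAtom {ι : Type*} (B : ι → Set Z) (A : Set ι) : Set Z := {z | ∀ i, z ∈ B i ↔ i ∈ A}

theorem measurableSet_partAtom {ι : Type*} [Finite ι] {B : ι → Set Z}
    (hB : ∀ i, MeasurableSet (B i)) (A : Set ι) : MeasurableSet (partAtom B A) := by
  have : partAtom B A = ⋂ i, {z | z ∈ B i ↔ i ∈ A} := by ext; simp [partAtom]
  rw [this]
  refine MeasurableSet.iInter fun i => ?_
  by_cases hi : i ∈ A
  · simpa [hi] using hB i
  · simp only [hi, iff_false]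
    exact (hB i).compl

omit [MeasurableSpace Z] in
theorem disjoint_partAtom {ι : Type*} (B : ι → Set Z) :
    Pairwise fun A A' => Disjoint (partAtom B A) (partAtom B A') := by
  intro A A' hA
  refine Set.disjoint_left.2 fun z hz hz' => hA ?_
  ext i
  rw [← hz i, ← hz' i]

theorem measure_eq_sum_partAtom {ι : Type*} [Fintype ι] [Fintype (Set ι)] {B : ι → Set Z}
    (hB : ∀ i, MeasurableSet (B i)) (m : Measure Z) (i : ι) [DecidablePred fun A : Set ι => i ∈ A] :
    m (B i) = ∑ A : Set ι with i ∈ A, m (partAtom B A) := by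
  rw [← measure_biUnion_finset (fun A _ A' _ h => disjoint_partAtom B h)
    fun A _ => measurableSet_partAtom hB A]
  congr 1
  ext z
  simp only [Finset.mem_filter, Finset.mem_univ, true_and, mem_iUnion, exists_prop]
  constructor
  · exact fun hz => ⟨{j | z ∈ B j}, hz, fun j => Iff.rfl⟩
  · rintro ⟨A, hA, hz⟩
    exact (hz i).2 hA

/-- Counts of overlapping sets are a fixed measurable function `g` of the counts of the atoms they
generate. The atoms are disjoint, so their joint law is a product of marginals fixed by the
intensity. -/
theorem IsPoissonProcess.map_counts_eq {X : Ω → PointMeasure Z} {X' : Ω' → PointMeasure Z}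
    {Λ : Measure Z} {P : Measure Ω} {P' : Measure Ω'} [IsProbabilityMeasure P]
    [IsProbabilityMeasure P'] (h : IsPoissonProcess X Λ P) (h' : IsPoissonProcess X' Λ P')
    {ι : Type*} [Fintype ι] {B : ι → Set Z} (hB : ∀ i, MeasurableSet (B i)) :
    P.map (fun w i => (X w).1 (B i)) = P'.map fun w i => (X' w).1 (B i) := by
  classical
  have hC := measurableSet_partAtom hB
  let g : (Set ι → ℝ≥0∞) → ι → ℝ≥0∞ := fun c i => ∑ A : Set ι with i ∈ A, c A
  have hg : Measurable g := measurable_pi_lambda _ fun i =>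
    Finset.measurable_sum _ fun A _ => measurable_pi_apply A
  have key : ∀ m : Measure Z, (fun i => m (B i)) = g fun A => m (partAtom B A) := fun m =>
    funext fun i => measure_eq_sum_partAtom hB m i
  have hm : Measurable fun w A => (X w).1 (partAtom B A) :=
    measurable_pi_lambda _ fun A => (measurable_count (hC A)).comp h.measurable
  have hm' : Measurable fun w A => (X' w).1 (partAtom B A) :=
    measurable_pi_lambda _ fun A => (measurable_count (hC A)).comp h'.measurable
  rw [show (fun w i => (X w).1 (B i)) = g ∘ fun w A => (X w).1 (partAtom B A) from
      funext fun w => key (X w).1,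
    show (fun w i => (X' w).1 (B i)) = g ∘ fun w A => (X' w).1 (partAtom B A) from
      funext fun w => key (X' w).1, ← Measure.map_map hg hm, ← Measure.map_map hg hm',
    h.map_counts_disjoint hC (disjoint_partAtom B),
    h'.map_counts_disjoint hC (disjoint_partAtom B)]
  congr 2
  exact funext fun A => h.map_count_eq h' (hC A)

/-- All counts of a point measure. -/
def allCounts (E : PointMeasure Z) (B : {B : Set Z // MeasurableSet B}) : ℝ≥0∞ := E.1 B.1

theorem measurable_allCounts : Measurable (allCounts (Z := Z)) :=
  measurable_pi_lambda _ fun B => measurable_count B.2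

/-- The σ-algebra on point measures is generated by evaluations, hence pulled back from the product
σ-algebra. -/
theorem exists_preimage_allCounts {A : Set (PointMeasure Z)} (hA : MeasurableSet A) :
    ∃ A', MeasurableSet A' ∧ allCounts ⁻¹' A' = A := by
  suffices h : (inferInstance : MeasurableSpace (PointMeasure Z)) ≤
      MeasurableSpace.comap allCounts inferInstance from h A hA
  refine Measurable.comap_le (@Measure.measurable_of_measurable_coe _ _ _ (_) _ fun s hs => ?_)
  exact (measurable_pi_apply (⟨s, hs⟩ : {B : Set Z // MeasurableSet B})).comp
    (comap_measurable (allCounts (Z := Z)))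

/-- The law of a Poisson process is determined by its intensity. -/
theorem IsPoissonProcess.map_eq {X : Ω → PointMeasure Z} {X' : Ω' → PointMeasure Z}
    {Λ : Measure Z} {P : Measure Ω} {P' : Measure Ω'} [IsProbabilityMeasure P]
    [IsProbabilityMeasure P'] (h : IsPoissonProcess X Λ P) (h' : IsPoissonProcess X' Λ P') :
    P.map X = P'.map X' := by
  have hlim : (P.map X).map allCounts = (P'.map X').map allCounts := by
    have : IsProbabilityMeasure (P.map X) :=
      Measure.isProbabilityMeasure_map h.measurable.aemeasurable
    have : IsProbabilityMeasure ((P.map X).map allCounts) :=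
      Measure.isProbabilityMeasure_map measurable_allCounts.aemeasurable
    -- A finite measure on a product is determined by its finite-dimensional marginals, which
    -- `map_counts_eq` identifies.
    refine IsProjectiveLimit.unique
      (P := fun I => ((P.map X).map allCounts).map I.restrict) (fun I => rfl) fun I => ?_
    have hI := Finset.measurable_restrict
      (X := fun _ : {B : Set Z // MeasurableSet B} => ℝ≥0∞) I
    change _ = ((P.map X).map allCounts).map I.restrict
    rw [Measure.map_map hI measurable_allCounts, Measure.map_map hI measurable_allCounts,
      Measure.map_map (hI.comp measurable_allCounts) h.measurable,
      Measure.map_map (hI.comp measurable_allCounts) h'.measurable]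
    exact (h.map_counts_eq h' (B := fun i : I => i.1.1) fun i => i.1.2).symm
  ext A hA
  obtain ⟨A', hA', rfl⟩ := exists_preimage_allCounts hA
  rw [← Measure.map_apply measurable_allCounts hA', hlim,
    Measure.map_apply measurable_allCounts hA']

/-- Push-forward of point measures. -/
noncomputable def PointMeasure.map (e : Z ≃ᵐ Z') (E : PointMeasure Z) : PointMeasure Z' :=
  ⟨E.1.map e, by
    obtain ⟨m, hm, hE⟩ := E.2
    refine ⟨fun n => (m n).map e, fun n B hB => ?_, ?_⟩
    · rw [e.map_apply]
      exact hm n _ (e.measurable hB)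
    · rw [hE, Measure.map_sum e.measurable.aemeasurable]⟩

theorem PointMeasure.measurable_map (e : Z ≃ᵐ Z') : Measurable (PointMeasure.map e) := by
  refine measurable_comap_iff.2 ?_
  exact (Measure.measurable_map _ e.measurable).comp (comap_measurable _)

/-- Push-forward of point measures under a measurable equivalence is a measurable equivalence. -/
noncomputable def PointMeasure.mapEquiv (e : Z ≃ᵐ Z') : PointMeasure Z ≃ᵐ PointMeasure Z' where
  toFun := PointMeasure.map e
  invFun := PointMeasure.map e.symm
  left_inv E := Subtype.ext (by simp [PointMeasure.map])
  right_inv E := Subtype.ext (by simp [PointMeasure.map])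
  measurable_toFun := PointMeasure.measurable_map e
  measurable_invFun := PointMeasure.measurable_map e.symm

theorem IsPoissonProcess.mapEquiv {X : Ω → PointMeasure Z} {Λ : Measure Z} {P : Measure Ω}
    (h : IsPoissonProcess X Λ P) (e : Z ≃ᵐ Z') :
    IsPoissonProcess (fun w => PointMeasure.mapEquiv e (X w)) (Λ.map e) P := by
  have happ : ∀ (w : Ω) (B : Set Z'), (PointMeasure.mapEquiv e (X w)).1 B = (X w).1 (e ⁻¹' B) :=
    fun w B => e.map_apply B
  refine ⟨(PointMeasure.mapEquiv e).measurable.comp h.measurable, fun B hB hΛ k => ?_,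
    fun B hB hΛ => ?_, fun n B hB hd => ?_⟩
  · rw [e.map_apply] at hΛ ⊢
    simp only [happ]
    exact h.count _ (e.measurable hB) hΛ k
  · rw [e.map_apply] at hΛ
    simp only [happ]
    exact h.count_top _ (e.measurable hB) hΛ
  · simp only [happ]
    exact h.indep n _ (fun i => e.measurable (hB i)) fun i j hij => (hd hij).preimage e

end Poisson

/-! ### Hyperspaces -/

section Hyperspace

variable {Y Y' : Type*} [TopologicalSpace Y] [TopologicalSpace Y']

theorem Hyperspace.continuous_image {g : Y → Y'} (hg : Continuous g) :
    Continuous (Hyperspace.image g) := by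
  let := TopologicalSpace.vietoris Y
  let := TopologicalSpace.vietoris Y'
  rw [continuous_induced_rng]
  exact hg.image_vietoris.comp continuous_induced_dom

/-- The map of hyperspaces induced by a homeomorphism, as a measurable equivalence. -/
def Hyperspace.imageEquiv (g : Y ≃ₜ Y') : Hyperspace Y ≃ᵐ Hyperspace Y' where
  toFun := Hyperspace.image g
  invFun := Hyperspace.image g.symm
  left_inv S := by ext; simp [Hyperspace.image]
  right_inv S := by ext; simp [Hyperspace.image]
  measurable_toFun := (Hyperspace.continuous_image g.continuous).borel_measurable
  measurable_invFun := (Hyperspace.continuous_image g.symm.continuous).borel_measurable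

end Hyperspace

/-! ### The coordinate changes -/

/-- The spatial scaling `x ↦ x / l`. -/
noncomputable def xEquiv {l : ℝ} (hl : 0 < l) : E3 ≃ᵐ E3 :=
  (Homeomorph.smulOfNeZero l⁻¹ (inv_ne_zero hl.ne')).toMeasurableEquiv

/-- The temporal scaling `t ↦ t / θ` as a homeomorphism. -/
noncomputable def tHomeomorph {θ : ℝ} (hθ : 0 < θ) : ℝ ≃ₜ ℝ where
  toFun t := t / θ
  invFun t := t * θ
  left_inv t := div_mul_cancel₀ t hθ.ne'
  right_inv t := mul_div_cancel_right₀ t hθ.ne'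

/-- The temporal scaling `t ↦ t / θ`. -/
noncomputable def tEquiv {θ : ℝ} (hθ : 0 < θ) : ℝ ≃ᵐ ℝ := (tHomeomorph hθ).toMeasurableEquiv

/-- The map `sBar` as a homeomorphism. -/
noncomputable def sBarHomeomorph {θ l : ℝ} (hθ : 0 < θ) (hl : 0 < l) : ST ≃ₜ ST :=
  (tHomeomorph hθ).prodCongr (Homeomorph.smulOfNeZero l⁻¹ (inv_ne_zero hl.ne'))

/-- The map `sBar` as a measurable equivalence. -/
noncomputable def sBarEquiv {θ l : ℝ} (hθ : 0 < θ) (hl : 0 < l) : ST ≃ᵐ ST :=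
  (tEquiv hθ).prodCongr (xEquiv hl)

/-- The scaling `(t, a, b) ↦ (t/θ, a/l, b/l)` of detection events. -/
noncomputable def evEquiv {θ l : ℝ} (hθ : 0 < θ) (hl : 0 < l) : Ev ≃ᵐ Ev :=
  (tEquiv hθ).prodCongr ((xEquiv hl).prodCongr (xEquiv hl))

/-! ### Scaling of the scanner geometry, the forward operator and the reference measure. -/

section Scale

variable {θ l : ℝ} (hθ : 0 < θ) (hl : 0 < l)

theorem xEquiv_apply (x : E3) : xEquiv hl x = l⁻¹ • x := rfl

theorem tEquiv_apply (t : ℝ) : tEquiv hθ t = t / θ := rfl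

theorem coe_sBarEquiv : ⇑(sBarEquiv hθ hl) = sBar θ l := rfl

theorem evEquiv_apply (z : Ev) : evEquiv hθ hl z = (z.1 / θ, l⁻¹ • z.2.1, l⁻¹ • z.2.2) := rfl

include hl in
theorem frontier_inv_smul (K : Set E3) : frontier (l⁻¹ • K) = l⁻¹ • frontier K := by
  have := (Homeomorph.smulOfNeZero (α := E3) l⁻¹ (inv_ne_zero hl.ne')).image_frontier K
  exact this.symm

theorem xEquiv_preimage_smul (K : Set E3) : xEquiv hl ⁻¹' (l⁻¹ • K) = K := by
  ext x
  rw [mem_preimage, xEquiv_apply, smul_mem_smul_set_iff₀ (inv_ne_zero hl.ne')]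

theorem ofReal_ne_zero {r : ℝ} (hr : 0 < r) : ENNReal.ofReal r ≠ 0 :=
  (ENNReal.ofReal_pos.2 hr).ne'

include hl in
theorem hausdorff2_inv_smul (s : Set E3) :
    hausdorff2 (l⁻¹ • s) = ENNReal.ofReal ((l ^ 2)⁻¹) * hausdorff2 s := by
  have hl' := inv_pos.2 hl
  rw [hausdorff2, Measure.smul_apply, Measure.smul_apply,
    Measure.hausdorffMeasure_smul₀ zero_le_two hl'.ne', smul_eq_mul, smul_eq_mul,
    ENNReal.smul_def, smul_eq_mul, mul_left_comm, ← inv_pow, ENNReal.ofReal_pow hl'.le,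
    ← Real.enorm_of_nonneg hl'.le, NNReal.rpow_ofNat, ENNReal.coe_pow]
  rfl

theorem surface_scale (K : Set E3) :
    surface (l⁻¹ • K) = ENNReal.ofReal ((l ^ 2)⁻¹) • (surface K).map (xEquiv hl) := by
  ext s hs
  rw [Measure.smul_apply, (xEquiv hl).map_apply, surface, surface, Measure.restrict_apply hs,
    Measure.restrict_apply ((xEquiv hl).measurable hs), frontier_inv_smul hl, smul_eq_mul,
    ← hausdorff2_inv_smul hl]
  congr 1
  rw [smul_set_inter₀ (inv_ne_zero hl.ne')]
  congr 1
  exact ((xEquiv hl).toEquiv.image_preimage s).symm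

include hl in
-- The direction `v` is kept, so the parameters of boundary points on the line shrink by `l⁻¹`. Real
-- `sInf` and `sSup` are homogeneous for nonnegative factors even at their default values, so
-- neither convexity nor compactness enters.
theorem hit_scale (K : Set E3) (x v : E3) :
    hit (l⁻¹ • K) (l⁻¹ • x) v = (l⁻¹ • (hit K x v).1, l⁻¹ • (hit K x v).2) := by
  have hset : {r : ℝ | l⁻¹ • x + r • v ∈ frontier (l⁻¹ • K)} =
      l⁻¹ • {r : ℝ | x + r • v ∈ frontier K} := by
    ext r
    rw [frontier_inv_smul hl, mem_inv_smul_set_iff₀ hl.ne']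
    change l⁻¹ • x + r • v ∈ l⁻¹ • frontier K ↔ x + (l • r) • v ∈ frontier K
    rw [mem_inv_smul_set_iff₀ hl.ne', smul_add, smul_inv_smul₀ hl.ne', smul_smul, smul_eq_mul]
  have hl' : (0 : ℝ) ≤ l⁻¹ := (inv_pos.2 hl).le
  simp only [hit, hset, Real.sInf_smul_of_nonneg hl', Real.sSup_smul_of_nonneg hl', smul_add,
    smul_eq_mul, mul_smul]

variable {c : ℝ≥0∞} (C : Scanner)

include hθ hl in
-- Dilations are additive, hence compatible with convolution in space.
theorem positronRange_scale (γ : Measure E3) (ρ : Measure ST) :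
    positronRange (γ.map fun x => l⁻¹ • x) (c • ρ.map (sBar θ l)) =
      c • (positronRange γ ρ).map (sBar θ l) := by
  rw [positronRange, positronRange, ← coe_sBarEquiv hθ hl,
    show (fun x : E3 => l⁻¹ • x) = xEquiv hl from rfl, smul_measure_prod, prod_map_equiv,
    Measure.map_smul]
  congr 1
  refine map_map_equiv_conj _ _ (fun p => ?_) _
  exact Prod.ext rfl (smul_add l⁻¹ p.1.2 p.2).symm

theorem detectors_scale (K : Set E3) (m : Measure ST) :
    detectors (l⁻¹ • K) (lines (c • m.map (sBar θ l))) =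
      c • (detectors K (lines m)).map (evEquiv hθ hl) := by
  have h := prod_map_equiv (sBarEquiv hθ hl) (MeasurableEquiv.refl S2) m volS2
  rw [show ⇑(MeasurableEquiv.refl S2) = id from rfl, Measure.map_id] at h
  rw [detectors, detectors, lines, lines, ← coe_sBarEquiv hθ hl, smul_measure_prod, h,
    Measure.map_smul]
  congr 1
  refine map_map_equiv_conj _ _ (fun p => ?_) _
  exact Prod.ext rfl (hit_scale hl K p.1.2 p.2)

theorem detectOp_scale (ρ : Measure ST) :
    detectOp (C.scale l) (c • ρ.map (sBar θ l)) = c • (detectOp C ρ).map (evEquiv hθ hl) := by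
  rw [detectOp, detectOp, ← detectors_scale, ← positronRange_scale hθ hl]
  rfl

theorem surface_prod_scale (K : Set E3) :
    (surface (l⁻¹ • K)).prod (surface (l⁻¹ • K)) = (ENNReal.ofReal ((l ^ 2)⁻¹) ^ 2) •
      ((surface K).prod (surface K)).map ((xEquiv hl).prodCongr (xEquiv hl)) := by
  rw [surface_scale hl, smul_measure_prod,
    measure_prod_smul (ofReal_ne_zero (by positivity)) ENNReal.ofReal_ne_top, prod_map_equiv,
    smul_smul, ← sq]

include hl in
theorem surface_scale_univ (K : Set E3) :
    surface (l⁻¹ • K) univ = ENNReal.ofReal ((l ^ 2)⁻¹) * surface K univ := by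
  rw [surface_scale hl, Measure.smul_apply, (xEquiv hl).map_apply, preimage_univ, smul_eq_mul]

include hθ hl in
-- The two surface measures contribute `l⁻⁴`, which the normalization by the squared area cancels.
-- Only the scaling factor must be nonzero and finite; the area itself need not be.
theorem scatterOp_scale (ρ : Measure ST) :
    scatterOp (C.scale l) (c • ρ.map (sBar θ l)) = c • (scatterOp C ρ).map (evEquiv hθ hl) := by
  have h0 : ENNReal.ofReal ((l ^ 2)⁻¹) ^ 2 ≠ 0 := pow_ne_zero _ (ofReal_ne_zero (by positivity))
  have ht : ENNReal.ofReal ((l ^ 2)⁻¹) ^ 2 ≠ ⊤ := ENNReal.pow_ne_top ENNReal.ofReal_ne_top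
  have hfst : (ρ.map (sBar θ l)).map Prod.fst = (ρ.map Prod.fst).map (tEquiv hθ) := by
    rw [← coe_sBarEquiv hθ hl]
    exact map_map_equiv_conj (sBarEquiv hθ hl) (tEquiv hθ) (fun p => rfl) ρ
  rw [scatterOp, scatterOp, show (C.scale l).body = l⁻¹ • C.body from rfl, Measure.map_smul, hfst,
    smul_measure_prod, surface_prod_scale hl, measure_prod_smul h0 ht, prod_map_equiv,
    surface_scale_univ hl, mul_pow, ENNReal.mul_inv (Or.inl h0) (Or.inl ht), Measure.map_smul,
    smul_smul, smul_smul, smul_smul]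
  congr 1
  rw [mul_right_comm, mul_comm _ c, ← mul_assoc, mul_right_comm _ _ (_ ^ 2), mul_assoc c,
    ← mul_assoc _ _⁻¹, ENNReal.mul_inv_cancel h0 ht, one_mul]

theorem forwardCont_scale (q : ℝ) (ρ : Measure ST) :
    forwardCont (C.scale l) q (c • ρ.map (sBar θ l)) =
      c • (forwardCont C q ρ).map (evEquiv hθ hl) := by
  rw [forwardCont, forwardCont, scatterOp_scale hθ hl, detectOp_scale hθ hl,
    Measure.map_add _ _ (evEquiv hθ hl).measurable, Measure.map_smul, Measure.map_smul, smul_add,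
    smul_comm c, smul_comm c]
  rfl

theorem bin_scale (b : Binning) (T : ℝ) (i : Fin b.numBins) :
    tEquiv hθ ⁻¹' ((b.scale l).bin (T / θ) i) = b.bin T i := by
  ext t
  simp only [Binning.bin, mem_preimage, mem_Ico, tEquiv_apply, Binning.scale]
  rw [show (i : ℝ) * (T / θ / b.numBins) = i * (T / b.numBins) / θ by ring,
    show ((i : ℝ) + 1) * (T / θ / b.numBins) = (i + 1) * (T / b.numBins) / θ by ring,
    div_le_div_iff_of_pos_right hθ, div_lt_div_iff_of_pos_right hθ]

theorem node_scale (b : Binning) (T : ℝ) (i : Fin b.numBins) (j k : Fin b.numDet) :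
    (b.scale l).node (T / θ) i j k = evEquiv hθ hl (b.node T i j k) := by
  refine Prod.ext ?_ rfl
  simp only [Binning.node, evEquiv_apply, Binning.scale]
  ring

/-- The rescaled cells pull back to the original ones, so they carry the same masses up to `c`, and
the nodes are moved by `evEquiv`. -/
theorem discretize_scale (b : Binning) (T : ℝ) (m : Measure Ev) :
    (b.scale l).discretize (T / θ) (c • m.map (evEquiv hθ hl)) =
      c • (b.discretize T m).map (evEquiv hθ hl) := by
  have hm := (evEquiv hθ hl).measurable
  have hset : ∀ i j k, evEquiv hθ hl ⁻¹' ((b.scale l).bin (T / θ) i ×ˢ (b.scale l).det j ×ˢ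
      (b.scale l).det k) = b.bin T i ×ˢ b.det j ×ˢ b.det k := by
    intro i j k
    rw [← bin_scale (l := l) hθ b T i, ← xEquiv_preimage_smul hl (b.det j),
      ← xEquiv_preimage_smul hl (b.det k)]
    rfl
  simp only [Binning.discretize]
  rw [← Measure.mapₗ_apply_of_measurable hm (∑ i, _)]
  simp only [map_sum, map_smul, Finset.smul_sum]
  refine Finset.sum_congr rfl fun i _ => Finset.sum_congr rfl fun j _ =>
    Finset.sum_congr rfl fun k _ => ?_
  rw [Measure.mapₗ_apply_of_measurable hm, Measure.map_dirac' hm, Measure.smul_apply, (evEquiv hθ hl).map_apply, hset, smul_smul, smul_eq_mul]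
  exact congrArg (fun z => _ • Measure.dirac z) (node_scale hθ hl b T i j k)

theorem forwardQ_scale (T q : ℝ) (ρ : Measure ST) :
    forwardQ (C.scale l) (T / θ) q (c • ρ.map (sBar θ l)) =
      c • (forwardQ C T q ρ).map (evEquiv hθ hl) := by
  have h := forwardCont_scale hθ hl (c := c) C q ρ
  obtain ⟨D, K, g, γ, pS, pD, _ | b⟩ := C
  · exact h
  · exact (congrArg _ h).trans (discretize_scale hθ hl b T _)

theorem restrict_Icc_scale (T : ℝ) :
    (volume.restrict (Icc 0 (T / θ)) : Measure ℝ) =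
      ENNReal.ofReal θ⁻¹ • (volume.restrict (Icc 0 T)).map (tEquiv hθ) := by
  have hpre : tEquiv hθ ⁻¹' Icc 0 (T / θ) = Icc 0 T := by
    ext t
    simp only [mem_preimage, mem_Icc, tEquiv_apply, div_le_div_iff_of_pos_right hθ]
    rw [le_div_iff₀ hθ, zero_mul]
  have hvol : (volume : Measure ℝ) = ENNReal.ofReal θ⁻¹ • (volume : Measure ℝ).map (tEquiv hθ) := by
    have h := Real.smul_map_volume_mul_right (a := θ⁻¹) (inv_ne_zero hθ.ne')
    rw [abs_of_pos (inv_pos.2 hθ)] at h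
    refine h.symm.trans ?_
    congr 2
  conv_lhs => rw [hvol]
  rw [Measure.restrict_smul, (tEquiv hθ).restrict_map, hpre]

/-- The factor relating the reference measures before and after scaling. -/
noncomputable def refFactor (C : Scanner) (θ l : ℝ) : ℝ :=
  match C.binning with
  | none => θ⁻¹ * ((l ^ 2)⁻¹) ^ 2
  | some _ => 1

include hθ hl in
theorem refFactor_pos : 0 < refFactor C θ l := by
  unfold refFactor
  split <;> positivity

/-- Continuous setting: `θ⁻¹` comes from time and `l⁻²` from each surface. Discrete setting:
counting on nodes is transported without a factor. -/
theorem refMeasure_scale (T : ℝ) :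
    refMeasure (C.scale l) (T / θ) =
      ENNReal.ofReal (refFactor C θ l) • (refMeasure C T).map (evEquiv hθ hl) := by
  obtain ⟨D, K, g, γ, pS, pD, _ | b⟩ := C
  · have h0 : ENNReal.ofReal ((l ^ 2)⁻¹) ^ 2 ≠ 0 :=
      pow_ne_zero _ (ofReal_ne_zero (by positivity))
    have ht : ENNReal.ofReal ((l ^ 2)⁻¹) ^ 2 ≠ ⊤ := ENNReal.pow_ne_top ENNReal.ofReal_ne_top
    change (volume.restrict (Icc 0 (T / θ))).prod
      ((surface (l⁻¹ • K)).prod (surface (l⁻¹ • K))) = ENNReal.ofReal (θ⁻¹ * ((l ^ 2)⁻¹) ^ 2) •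
        ((volume.restrict (Icc 0 T)).prod ((surface K).prod (surface K))).map _
    rw [restrict_Icc_scale hθ, surface_prod_scale hl, smul_measure_prod, measure_prod_smul h0 ht,
      prod_map_equiv, smul_smul, ENNReal.ofReal_mul (by positivity),
      ENNReal.ofReal_pow (by positivity)]
    rfl
  · have hm := (evEquiv hθ hl).measurable
    change ∑ i, ∑ j, ∑ k, Measure.dirac ((b.scale l).node (T / θ) i j k) = ENNReal.ofReal 1 •
      (∑ i, ∑ j, ∑ k, Measure.dirac (b.node T i j k)).map _
    rw [ENNReal.ofReal_one, one_smul]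
    simp only [← Measure.mapₗ_apply_of_measurable hm, map_sum]
    simp only [Measure.mapₗ_apply_of_measurable hm, Measure.map_dirac' hm, ← node_scale hθ hl]
    rfl

theorem evEquiv_mem_eventSet (T : ℝ) (z : Ev) :
    evEquiv hθ hl z ∈ eventSet (C.scale l) (T / θ) ↔ z ∈ eventSet C T := by
  obtain ⟨D, K, g, γ, pS, pD, _ | b⟩ := C
  · change _ ∈ Icc 0 (T / θ) ×ˢ frontier (l⁻¹ • K) ×ˢ frontier (l⁻¹ • K) ↔
      z ∈ Icc 0 T ×ˢ frontier K ×ˢ frontier K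
    simp only [evEquiv_apply, mem_prod, frontier_inv_smul hl, mem_Icc,
      smul_mem_smul_set_iff₀ (inv_ne_zero hl.ne'), div_le_div_iff_of_pos_right hθ]
    rw [le_div_iff₀ hθ, zero_mul]
  · change (∃ i j k, _ = (b.scale l).node (T / θ) i j k) ↔ ∃ i j k, z = b.node T i j k
    refine exists_congr fun i => exists_congr fun j => exists_congr fun k => ?_
    exact (Eq.congr_right (node_scale hθ hl b T i j k)).trans (evEquiv hθ hl).injective.eq_iff

theorem measurableSet_eventSet (T : ℝ) : MeasurableSet (eventSet C T) := by
  obtain ⟨D, K, g, γ, pS, pD, _ | b⟩ := C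
  · exact (isClosed_Icc.prod (isClosed_frontier.prod isClosed_frontier)).measurableSet
  · change MeasurableSet {z | ∃ i j k, z = b.node T i j k}
    simp only [ofPred_exists]
    exact .iUnion fun _ => .iUnion fun _ => .iUnion fun _ => measurableSet_singleton _

end Scale

/-! ### Rescaling of states -/

section Rescale

variable {θ l μ : ℝ} (hθ : 0 < θ) (hl : 0 < l) (hμ : 0 < μ)

include hμ in
theorem rescaleTruth_eq (ρ : FiniteMeasure ST) :
    (rescaleTruth θ l μ ρ : Measure ST) =
      ENNReal.ofReal ((μ * θ)⁻¹) • (ρ : Measure ST).map (sBar θ l) := by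
  have h : ((1 / μ).toNNReal • (1 / θ).toNNReal • (ρ : Measure ST).map (sBar θ l)) =
      ENNReal.ofReal ((μ * θ)⁻¹) • (ρ : Measure ST).map (sBar θ l) := by
    rw [smul_smul, ← Real.toNNReal_mul (by positivity), one_div_mul_one_div, one_div]
    rfl
  exact h

include hμ in
theorem rescale_rho (y : State) :
    ((y.rescale θ l μ).rho : Measure ST) =
      ENNReal.ofReal ((μ * θ)⁻¹) • (y.rho : Measure ST).map (sBar θ l) := by
  rw [← rescaleTruth_eq hμ, State.rescale, rescaleTruth, SBar, SBar, FiniteMeasure.map_smul,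
    smul_comm]

include hθ in
theorem rescale_eta (y : State) :
    (y.rescale θ l μ).eta = (μ * l)⁻¹ • y.eta.map (sBar θ l) := by
  rw [State.rescale, SBarVec, VectorMeasure.map_smul, smul_smul]
  field_simp

include hθ hl in
theorem sBar_inv_sBar (z : ST) : sBar θ⁻¹ l⁻¹ (sBar θ l z) = z := by
  refine Prod.ext ?_ ?_
  · simp [sBar, hθ.ne']
  · simp [sBar, smul_smul, hl.ne']

include hθ hl hμ in
theorem rescale_inv_rescale (y : State) : (y.rescale θ l μ).rescale θ⁻¹ l⁻¹ μ⁻¹ = y := by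
  have hθ' := inv_pos.2 hθ
  have hl' := inv_pos.2 hl
  have hs : sBar θ⁻¹ l⁻¹ ∘ sBar θ l = id := funext fun z => sBar_inv_sBar hθ hl z
  have hm : Measurable (sBar θ l) := (sBarEquiv hθ hl).measurable
  have hm' : Measurable (sBar θ⁻¹ l⁻¹) := (sBarEquiv hθ' hl').measurable
  refine State.ext (FiniteMeasure.toMeasure_injective ?_) ?_
  · rw [rescale_rho (inv_pos.2 hμ), rescale_rho hμ, Measure.map_smul, Measure.map_map hm' hm, hs,
      Measure.map_id, smul_smul, ← ENNReal.ofReal_mul (by positivity)]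
    rw [show (μ⁻¹ * θ⁻¹)⁻¹ * (μ * θ)⁻¹ = 1 by field_simp, ENNReal.ofReal_one, one_smul]
  · rw [rescale_eta hθ', rescale_eta hθ, VectorMeasure.map_smul, smul_smul,
      show (μ⁻¹ * l⁻¹)⁻¹ * (μ * l)⁻¹ = 1 by field_simp, one_smul]
    ext s hs' : 1
    rw [VectorMeasure.map_apply _ hm' hs', VectorMeasure.map_apply _ hm (hm' hs'),
      ← preimage_comp, hs, preimage_id]

include hθ hl hμ in
theorem rescale_rescale_inv (y : State) : (y.rescale θ⁻¹ l⁻¹ μ⁻¹).rescale θ l μ = y := by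
  simpa using rescale_inv_rescale (inv_pos.2 hθ) (inv_pos.2 hl) (inv_pos.2 hμ) y

include hθ hl hμ in
theorem integral_rescale_rho (y : State) {F : Type*} [NormedAddCommGroup F] [NormedSpace ℝ F]
    (f : ST → F) :
    ∫ z, f z ∂((y.rescale θ l μ).rho : Measure ST) =
      (ENNReal.ofReal (μ * θ)⁻¹).toReal • ∫ z, f (sBar θ l z) ∂(y.rho : Measure ST) := by
  rw [rescale_rho hμ, integral_smul_measure, ← coe_sBarEquiv hθ hl, integral_map_equiv]

include hθ hl in
theorem integral_rescale_eta (y : State) {F G : Type*} [NormedAddCommGroup F] [NormedSpace ℝ F]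
    [NormedAddCommGroup G] [NormedSpace ℝ G] (f : ST → F) (B : F →L[ℝ] E3 →L[ℝ] G) :
    (y.rescale θ l μ).eta.integral f B = (μ * l)⁻¹ • y.eta.integral (fun z => f (sBar θ l z)) B := by
  rw [rescale_eta hθ, VectorMeasure.integral_smul_vectorMeasure, ← coe_sBarEquiv hθ hl,
    VectorMeasure.integral_map_equiv]

include hθ hl hμ in
-- The topology is induced by the integrals of bounded continuous `f`. Rescaling replaces `f` by `f
-- ∘ sBar`, again bounded and continuous, and multiplies by a constant.
theorem continuous_rescale : Continuous (State.rescale θ l μ) := by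
  refine continuous_induced_rng.2 (continuous_pi fun f => ?_)
  let g := f.compContinuous ⟨sBar θ l, (sBarHomeomorph hθ hl).continuous⟩
  have h := (continuous_apply g).comp (continuous_induced_dom (α := State)
    (f := fun y (f : BoundedContinuousFunction ST ℝ) => (∫ z, f z ∂(y.rho : Measure ST),
      y.eta.integral (fun z => f z) (ContinuousLinearMap.lsmul ℝ ℝ))))
  have h' : (fun y : State => (∫ z, f z ∂((y.rescale θ l μ).rho : Measure ST),
      (y.rescale θ l μ).eta.integral (fun z => f z) (ContinuousLinearMap.lsmul ℝ ℝ))) =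
      fun y : State => ((ENNReal.ofReal (μ * θ)⁻¹).toReal • ∫ z, g z ∂(y.rho : Measure ST),
        (μ * l)⁻¹ • y.eta.integral (fun z => g z) (ContinuousLinearMap.lsmul ℝ ℝ)) := by
    funext y
    rw [integral_rescale_rho hθ hl hμ, integral_rescale_eta hθ hl]
    rfl
  refine Eq.mpr (congrArg Continuous h') ?_
  exact (h.fst.const_smul (ENNReal.ofReal (μ * θ)⁻¹).toReal).prodMk (h.snd.const_smul (μ * l)⁻¹)

/-- The rescaling of states, as a homeomorphism. -/
noncomputable def rescaleHomeomorph : State ≃ₜ State where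
  toFun := State.rescale θ l μ
  invFun := State.rescale θ⁻¹ l⁻¹ μ⁻¹
  left_inv := rescale_inv_rescale hθ hl hμ
  right_inv := rescale_rescale_inv hθ hl hμ
  continuous_toFun := continuous_rescale hθ hl hμ
  continuous_invFun := continuous_rescale (inv_pos.2 hθ) (inv_pos.2 hl) (inv_pos.2 hμ)

theorem sBar_preimage (D : Set E3) (T : ℝ) :
    sBarEquiv hθ hl ⁻¹' (Icc 0 (T / θ) ×ˢ (l⁻¹ • D)) = Icc 0 T ×ˢ D := by
  ext z
  change z.1 / θ ∈ Icc 0 (T / θ) ∧ l⁻¹ • z.2 ∈ l⁻¹ • D ↔ z.1 ∈ Icc 0 T ∧ z.2 ∈ D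
  rw [mem_Icc, mem_Icc, smul_mem_smul_set_iff₀ (inv_ne_zero hl.ne'),
    div_le_div_iff_of_pos_right hθ, le_div_iff₀ hθ, zero_mul]

include hθ hl hμ in
theorem rescale_mem_stateSet {D : Set E3} {T : ℝ} {y : State} (hy : y ∈ stateSet D T) :
    y.rescale θ l μ ∈ stateSet (l⁻¹ • D) (T / θ) := by
  refine ⟨?_, fun B hB hd => ?_⟩
  · rw [rescale_rho hμ, Measure.smul_apply, ← coe_sBarEquiv hθ hl, (sBarEquiv hθ hl).map_apply,
      preimage_compl, sBar_preimage, hy.1, smul_zero]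
  · have hm := (sBarEquiv hθ hl).measurable
    rw [rescale_eta hθ, _root_.smul_apply, ← coe_sBarEquiv hθ hl,
      VectorMeasure.map_apply _ hm hB, hy.2 _ (hm hB), smul_zero]
    rw [← sBar_preimage hθ hl]
    exact hd.preimage _

include hθ hl hμ in
theorem rescale_mem_stateSet_iff {D : Set E3} {T : ℝ} {y : State} :
    y.rescale θ l μ ∈ stateSet (l⁻¹ • D) (T / θ) ↔ y ∈ stateSet D T := by
  refine ⟨fun h => ?_, rescale_mem_stateSet hθ hl hμ⟩
  have := rescale_mem_stateSet (inv_pos.2 hθ) (inv_pos.2 hl) (inv_pos.2 hμ) h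
  rwa [rescale_inv_rescale hθ hl hμ, inv_inv, smul_inv_smul₀ hl.ne', div_inv_eq_mul,
    div_mul_cancel₀ _ hθ.ne'] at this

/-! ### The Benamou-Brenier functional -/

include hθ hl hμ in
theorem HasTimeSlices.rescale {y : State} (h : HasTimeSlices (y.rho : Measure ST)) :
    HasTimeSlices ((y.rescale θ l μ).rho : Measure ST) := by
  unfold HasTimeSlices at h ⊢
  rw [rescale_rho hμ, Measure.map_smul]
  refine Measure.AbsolutelyContinuous.smul_left ?_ _
  rw [← coe_sBarEquiv hθ hl, map_map_equiv_conj (sBarEquiv hθ hl) (tEquiv hθ) (g := Prod.fst)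
    (fun p => rfl)]
  refine (h.map (tEquiv hθ).measurable).trans ?_
  refine Measure.AbsolutelyContinuous.mk fun s hs h0 => ?_
  rw [(tEquiv hθ).map_apply]
  have : tEquiv hθ ⁻¹' s = (fun t => t * θ⁻¹) ⁻¹' s := by
    ext t; simp [tEquiv_apply, div_eq_mul_inv]
  rw [this, Real.volume_preimage_mul_right (inv_ne_zero hθ.ne'), h0, mul_zero]

/-- The map `sBar` as a continuous linear map. -/
noncomputable def sBarCLM (θ l : ℝ) : ST →L[ℝ] ST :=
  (θ⁻¹ • ContinuousLinearMap.id ℝ ℝ).prodMap (l⁻¹ • ContinuousLinearMap.id ℝ E3)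

theorem coe_sBarCLM : ⇑(sBarCLM θ l) = sBar θ l := by
  funext z
  exact Prod.ext (div_eq_inv_mul z.1 θ).symm rfl

theorem fderiv_comp_sBar {φ : ST → ℝ} (hφ : ContDiff ℝ ∞ φ) (z : ST) :
    fderiv ℝ (fun z => φ (sBar θ l z)) z = (fderiv ℝ φ (sBar θ l z)).comp (sBarCLM θ l) := by
  rw [← coe_sBarCLM]
  have h := fderiv_comp z (g := φ) (f := sBarCLM θ l)
    (hφ.differentiable (by simp)).differentiableAt (sBarCLM θ l).differentiableAt
  rw [ContinuousLinearMap.fderiv] at h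
  exact h

include hθ hl hμ in
-- Test with `φ ∘ sBar`: the chain rule yields `θ⁻¹` in time and `l⁻¹` in space. These match the
-- prefactors `(μθ)⁻¹` of `ρ` and `(μl)⁻¹` of `η`, so the weak equation is merely multiplied by
-- `μ⁻¹`.
theorem ContinuityEq.rescale {T : ℝ} {y : State} (h : ContinuityEq T y) :
    ContinuityEq (T / θ) (y.rescale θ l μ) := by
  intro φ hφ hc hs
  have hψ : ContDiff ℝ ∞ fun z => φ (sBar θ l z) := by
    rw [← coe_sBarCLM]
    exact hφ.comp (sBarCLM θ l).contDiff
  have hsupp : tsupport (fun z => φ (sBar θ l z)) = sBar θ l ⁻¹' tsupport φ :=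
    tsupport_comp_eq_preimage φ (sBarHomeomorph hθ hl)
  have key := h _ hψ (hc.comp_homeomorph (sBarHomeomorph hθ hl)) (by
    rw [hsupp]
    intro z hz
    obtain ⟨⟨h1, h2⟩, -⟩ := hs hz
    exact ⟨⟨by simpa [sBar, hθ] using h1, (div_lt_div_iff_of_pos_right hθ).1 h2⟩, trivial⟩)
  have e1 : ∀ z, fderiv ℝ (fun z => φ (sBar θ l z)) z (1, 0) =
      θ⁻¹ • fderiv ℝ φ (sBar θ l z) (1, 0) := by
    intro z
    rw [fderiv_comp_sBar hφ, ← map_smul]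
    simp [sBarCLM]
  have e2 : ∀ z, (fderiv ℝ (fun z => φ (sBar θ l z)) z).comp (ContinuousLinearMap.inr ℝ ℝ E3) =
      l⁻¹ • (fderiv ℝ φ (sBar θ l z)).comp (ContinuousLinearMap.inr ℝ ℝ E3) := by
    intro z
    rw [fderiv_comp_sBar hφ]
    ext x
    simp only [sBarCLM, ContinuousLinearMap.comp_apply, _root_.smul_apply, ← map_smul]
    simp
  simp only [e1, e2] at key
  rw [integral_smul, VectorMeasure.integral_fun_smul] at key
  rw [integral_rescale_rho hθ hl hμ, integral_rescale_eta hθ hl,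
    ENNReal.toReal_ofReal (by positivity), mul_inv, mul_inv, mul_smul, mul_smul, ← smul_add, key,
    smul_zero]

include hθ hl hμ in
-- Velocities are length over time and pick up `θ/l`, the quotient of the prefactors `(μl)⁻¹` and
-- `(μθ)⁻¹`.
theorem withDensityᵥ_rescale {y : State} {v : ST → E3}
    (hv : Integrable v (y.rho : Measure ST)) (h : y.eta = (y.rho : Measure ST).withDensityᵥ v) :
    Integrable (fun z => (θ / l) • v ((sBarEquiv hθ hl).symm z))
      ((y.rescale θ l μ).rho : Measure ST) ∧
    (y.rescale θ l μ).eta = ((y.rescale θ l μ).rho : Measure ST).withDensityᵥ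
      fun z => (θ / l) • v ((sBarEquiv hθ hl).symm z) := by
  have hi : Integrable (fun z => (θ / l) • v ((sBarEquiv hθ hl).symm z))
      ((y.rescale θ l μ).rho : Measure ST) := by
    rw [rescale_rho hμ, ← coe_sBarEquiv hθ hl]
    have h1 : Integrable (fun z => v ((sBarEquiv hθ hl).symm z))
        ((y.rho : Measure ST).map (sBarEquiv hθ hl)) := by
      rw [integrable_map_equiv]
      simpa [Function.comp_def] using hv
    exact (h1.smul_measure ENNReal.ofReal_ne_top).smul (θ / l)
  refine ⟨hi, ?_⟩
  have hm := (sBarEquiv hθ hl).measurable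
  ext s hs : 1
  rw [withDensityᵥ_apply hi hs, rescale_eta hθ, rescale_rho hμ, _root_.smul_apply,
    ← coe_sBarEquiv hθ hl, VectorMeasure.map_apply _ hm hs, h, withDensityᵥ_apply hv (hm hs),
    Measure.restrict_smul, integral_smul_measure, setIntegral_map_equiv, integral_smul,
    ENNReal.toReal_ofReal (by positivity), smul_smul]
  simp only [MeasurableEquiv.symm_apply_apply]
  congr 1
  field_simp

include hθ hl hμ in
-- Each admissible velocity is transported to an admissible one, and `(μθ)⁻¹ (θ/l)² = θ/(l²μ)`. The
-- reverse bound is this one for the inverse scaling.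
theorem benamouBrenier_rescale_le (T : ℝ) (y : State) :
    benamouBrenier (T / θ) (y.rescale θ l μ) ≤
      ENNReal.ofReal (θ / (l ^ 2 * μ)) * benamouBrenier T y := by
  have h0 : ENNReal.ofReal (θ / (l ^ 2 * μ)) ≠ 0 := ofReal_ne_zero (by positivity)
  simp only [benamouBrenier, ENNReal.mul_iInf_of_ne h0 ENNReal.ofReal_ne_top]
  refine le_iInf fun h1 => le_iInf fun h2 => le_iInf fun v => le_iInf fun hv => le_iInf fun h => ?_
  obtain ⟨hv', h'⟩ := withDensityᵥ_rescale hθ hl hμ hv h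
  refine iInf_le_of_le (h1.rescale hθ hl hμ) <| iInf_le_of_le (h2.rescale hθ hl hμ) <|
    iInf_le_of_le _ <| iInf_le_of_le hv' <| iInf_le_of_le h' ?_
  rw [rescale_rho hμ, ← coe_sBarEquiv hθ hl, lintegral_smul_measure, lintegral_map_equiv]
  simp only [MeasurableEquiv.symm_apply_apply, enorm_smul, mul_pow]
  rw [lintegral_const_mul' _ _ (by finiteness), smul_eq_mul, ← mul_assoc,
    Real.enorm_of_nonneg (by positivity), ← ENNReal.ofReal_pow (by positivity),
    ← ENNReal.ofReal_mul (by positivity)]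
  refine le_of_eq (congrArg (fun r => ENNReal.ofReal r * _) ?_)
  field_simp

include hθ hl hμ in
theorem mul_benamouBrenier_rescale {β : ℝ} (hβ : 0 < β) (T : ℝ) (y : State) :
    ENNReal.ofReal (β * μ * (l ^ 2 / θ)) * benamouBrenier (T / θ) (y.rescale θ l μ) =
      ENNReal.ofReal β * benamouBrenier T y := by
  refine le_antisymm ?_ ?_
  · refine (mul_le_mul_right (benamouBrenier_rescale_le hθ hl hμ T y) _).trans (le_of_eq ?_)
    rw [← mul_assoc, ← ENNReal.ofReal_mul (by positivity)]
    refine congrArg (fun r => ENNReal.ofReal r * _) ?_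
    field_simp
  · have h := benamouBrenier_rescale_le (inv_pos.2 hθ) (inv_pos.2 hl) (inv_pos.2 hμ) (T / θ)
      (y.rescale θ l μ)
    rw [rescale_inv_rescale hθ hl hμ, div_inv_eq_mul, div_mul_cancel₀ _ hθ.ne'] at h
    refine (mul_le_mul_right h _).trans (le_of_eq ?_)
    rw [← mul_assoc, ← ENNReal.ofReal_mul (by positivity)]
    refine congrArg (fun r => ENNReal.ofReal r * _) ?_
    field_simp

end Rescale

/-! ### Extended real arithmetic -/

/-- This is `y⁺ - y⁻ = y` for `x`, `k` and `k + x`, rearranged without subtraction so that it can be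
integrated in `ℝ≥0∞`; for infinite `x` both sides are `⊤`. -/
theorem toENNReal_coe_add_identity (k : ℝ) (x : EReal) :
    (-((k : EReal) + x)).toENNReal + x.toENNReal + ENNReal.ofReal k =
      ((k : EReal) + x).toENNReal + (-x).toENNReal + ENNReal.ofReal (-k) := by
  induction x with
  | bot => simp
  | top => simp
  | coe r =>
    rw [← EReal.coe_add, ← EReal.coe_neg, ← EReal.coe_neg]
    simp only [EReal.toENNReal_of_ne_top (EReal.coe_ne_top _), EReal.toReal_coe]
    rw [← ENNReal.toReal_eq_toReal_iff' (by finiteness) (by finiteness)]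
    repeat rw [ENNReal.toReal_add (by finiteness) (by finiteness)]
    simp only [ENNReal.toReal_ofReal']
    have h : ∀ x : ℝ, max x 0 - max (-x) 0 = x := fun x => by
      rcases le_total x 0 with hx | hx <;> simp [hx]
    linarith [h k, h r, h (k + r)]

theorem toENNReal_coe_add_le (k : ℝ) (x : EReal) :
    ((k : EReal) + x).toENNReal ≤ x.toENNReal + ENNReal.ofReal k := by
  rw [add_comm]
  refine EReal.toENNReal_add_le.trans_eq ?_
  rw [EReal.toENNReal_of_ne_top (EReal.coe_ne_top _), EReal.toReal_coe]

theorem le_toENNReal_coe_add (k : ℝ) (x : EReal) :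
    x.toENNReal ≤ ((k : EReal) + x).toENNReal + ENNReal.ofReal (-k) := by
  refine le_trans (le_of_eq ?_) (toENNReal_coe_add_le (-k) _)
  rw [← add_assoc, ← EReal.coe_add, neg_add_cancel, EReal.coe_zero, zero_add]

theorem neg_coe_add (k : ℝ) (x : EReal) : -((k : EReal) + x) = ((-k : ℝ) : EReal) + -x := by
  rw [EReal.neg_add (Or.inl (EReal.coe_ne_bot k)) (Or.inl (EReal.coe_ne_top k)), EReal.coe_neg,
    sub_eq_add_neg]

/-- The balance `h` fixes the difference only when all terms are finite. The four inequalities make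
`p, p'` and `n, n'` infinite simultaneously. -/
theorem coe_sub_coe_eq_add {n p n' p' a b : ℝ≥0∞} (ha : a ≠ ⊤) (hb : b ≠ ⊤)
    (h : n' + p + a = p' + n + b) (hn : n' ≤ n + b) (hn' : n ≤ n' + a) (hp : p' ≤ p + a)
    (hp' : p ≤ p' + b) :
    (n' : EReal) - p' = (n : EReal) - p + ((b.toReal - a.toReal : ℝ) : EReal) := by
  -- This case comes first because subtracting `⊤` in `EReal` gives `⊥` whatever `n` is.
  by_cases hpt : p = ⊤
  · have : p' = ⊤ := by
      by_contra hc
      exact (ENNReal.add_ne_top.2 ⟨hc, hb⟩) (top_le_iff.1 (hpt ▸ hp'))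
    simp [hpt, this]
  have hpt' : p' ≠ ⊤ := ne_top_of_le_ne_top (ENNReal.add_ne_top.2 ⟨hpt, ha⟩) hp
  lift p to ℝ≥0 using hpt
  lift p' to ℝ≥0 using hpt'
  by_cases hnt : n = ⊤
  · have : n' = ⊤ := by
      by_contra hc
      exact (ENNReal.add_ne_top.2 ⟨hc, ha⟩) (top_le_iff.1 (hnt ▸ hn'))
    rw [hnt, this]
    simp only [EReal.coe_ennreal_top, EReal.coe_nnreal_eq_coe_real, EReal.top_sub_coe,
      EReal.top_add_coe]
  have hnt' : n' ≠ ⊤ := ne_top_of_le_ne_top (ENNReal.add_ne_top.2 ⟨hnt, hb⟩) hn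
  lift n to ℝ≥0 using hnt
  lift n' to ℝ≥0 using hnt'
  lift a to ℝ≥0 using ha
  lift b to ℝ≥0 using hb
  have h' : (n' : ℝ) + p + a = p' + n + b := by exact_mod_cast h
  simp only [EReal.coe_nnreal_eq_coe_real, ENNReal.coe_toReal]
  rw [← EReal.coe_sub, ← EReal.coe_sub, ← EReal.coe_add]
  congr 1
  linarith

theorem iInf_add_coe {ι : Sort*} (f : ι → EReal) (k : ℝ) :
    ⨅ i, (f i + (k : EReal)) = (⨅ i, f i) + (k : EReal) := by
  refine le_antisymm ?_ (le_iInf fun i => add_le_add_left (iInf_le f i) _)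
  rw [← EReal.sub_le_iff_le_add (Or.inl (EReal.coe_ne_bot k)) (Or.inl (EReal.coe_ne_top k))]
  refine le_iInf fun i => ?_
  rw [EReal.sub_le_iff_le_add (Or.inl (EReal.coe_ne_bot k)) (Or.inl (EReal.coe_ne_top k))]
  exact iInf_le (fun i => f i + (k : EReal)) i

theorem add_coe_le_add_coe_iff {a b : EReal} (k : ℝ) :
    a + (k : EReal) ≤ b + (k : EReal) ↔ a ≤ b := by
  refine ⟨fun h => ?_, fun h => add_le_add_left h _⟩
  rw [← EReal.sub_le_iff_le_add (Or.inl (EReal.coe_ne_bot k)) (Or.inl (EReal.coe_ne_top k)),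
    EReal.add_sub_cancel_right] at h
  exact h

/-- Scaling the argument of the logarithm shifts the functional by a finite constant. -/
theorem negLogIntegral_const_mul {Z : Set Ev} {E : Measure Ev} (hE : E univ < ⊤) {κ : ℝ≥0∞}
    (h0 : κ ≠ 0) (ht : κ ≠ ⊤) {g : Ev → ℝ≥0∞} (hg : AEMeasurable g (E.restrict Z)) :
    negLogIntegral Z E (fun z => κ * g z) = negLogIntegral Z E g +
      ((ENNReal.ofReal (-(ENNReal.log κ).toReal) * E Z).toReal -
        (ENNReal.ofReal (ENNReal.log κ).toReal * E Z).toReal : ℝ) := by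
  have hEZ : E Z ≠ ⊤ := ((measure_mono (subset_univ Z)).trans_lt hE).ne
  obtain ⟨k, hk⟩ : ∃ k : ℝ, ENNReal.log κ = k :=
    ⟨_, (EReal.coe_toReal (by simpa using ht) (by simpa using h0)).symm⟩
  rw [hk, EReal.toReal_coe]
  have hlog : AEMeasurable (fun z => ENNReal.log (g z)) (E.restrict Z) :=
    ENNReal.measurable_log.comp_aemeasurable hg
  have hP : AEMeasurable (fun z => (ENNReal.log (g z)).toENNReal) (E.restrict Z) := by fun_prop
  have hN : AEMeasurable (fun z => (-(ENNReal.log (g z))).toENNReal) (E.restrict Z) := by fun_prop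
  have hcst : ∀ r : ℝ, ENNReal.ofReal r * E Z = ∫⁻ _ in Z, ENNReal.ofReal r ∂E := fun r => by
    rw [setLIntegral_const]
  have hfin : ∀ r : ℝ, ENNReal.ofReal r * E Z ≠ ⊤ := fun r =>
    ENNReal.mul_ne_top ENNReal.ofReal_ne_top hEZ
  simp only [negLogIntegral, ENNReal.log_mul_add, hk]
  -- All five conditions are integrals of pointwise relations between positive and negative parts.
  refine coe_sub_coe_eq_add (hfin _) (hfin _) ?_ ?_ ?_ ?_ ?_ <;>
    simp only [hcst, ← lintegral_add_right' _ hP, ← lintegral_add_right' _ hN,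
      ← lintegral_add_right _ measurable_const]
  · exact lintegral_congr fun z => toENNReal_coe_add_identity k _
  · refine lintegral_mono fun z => ?_
    rw [neg_coe_add]
    exact toENNReal_coe_add_le (-k) _
  · refine lintegral_mono fun z => ?_
    rw [neg_coe_add]
    simpa using le_toENNReal_coe_add (-k) (-(ENNReal.log (g z)))
  · exact lintegral_mono fun z => toENNReal_coe_add_le k _
  · exact lintegral_mono fun z => le_toENNReal_coe_add k _

/-! ### The reconstruction functional -/

section Functional

variable {θ l μ : ℝ} (hθ : 0 < θ) (hl : 0 < l) (hμ : 0 < μ) (C : Scanner)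

theorem continuous_evEquiv : Continuous (evEquiv hθ hl) :=
  ((tHomeomorph hθ).prodCongr ((Homeomorph.smulOfNeZero l⁻¹ (inv_ne_zero hl.ne')).prodCongr
    (Homeomorph.smulOfNeZero l⁻¹ (inv_ne_zero hl.ne')))).continuous

theorem continuous_evEquiv_symm : Continuous (evEquiv hθ hl).symm :=
  ((tHomeomorph hθ).prodCongr ((Homeomorph.smulOfNeZero l⁻¹ (inv_ne_zero hl.ne')).prodCongr
    (Homeomorph.smulOfNeZero l⁻¹ (inv_ne_zero hl.ne')))).symm.continuous

theorem decayRate_scale {τ c : ℝ} (hc : 0 < c) :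
    decayRate (τ / c) = ENNReal.ofReal c * decayRate τ := by
  rw [decayRate, decayRate, ← ENNReal.ofReal_mul hc.le]
  congr 1
  field_simp

theorem evEquiv_preimage_eventSet (T : ℝ) :
    evEquiv hθ hl ⁻¹' eventSet (C.scale l) (T / θ) = eventSet C T :=
  ext fun z => evEquiv_mem_eventSet hθ hl C T z

include hμ in
/-- The detection intensity is transported by the rescaling. -/
theorem decayRate_smul_forward_scale (τ T : ℝ) (ρ : Measure ST) :
    decayRate (τ / (μ * θ)) • forward (C.scale l) (T / θ)
        (ENNReal.ofReal ((μ * θ)⁻¹) • ρ.map (sBar θ l)) =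
      (decayRate τ • forward C T ρ).map (evEquiv hθ hl) := by
  have h : 0 < μ * θ := mul_pos hμ hθ
  rw [forward, forwardQ_scale hθ hl, smul_smul, Measure.map_smul, decayRate_scale h, mul_right_comm,
    ← ENNReal.ofReal_mul h.le, mul_inv_cancel₀ h.ne', ENNReal.ofReal_one, one_mul]
  rfl

/-- The factor by which densities of forward operators change under rescaling. -/
noncomputable def densityFactor (C : Scanner) (θ l μ : ℝ) : ℝ≥0 :=
  ((μ * θ)⁻¹ / refFactor C θ l).toNNReal

include hθ hl hμ in
theorem densityFactor_pos : 0 < densityFactor C θ l μ :=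
  Real.toNNReal_pos.2 (div_pos (by positivity) (refFactor_pos hθ hl C))

/-- The rescaling of densities. -/
noncomputable def scaleDensity (f : Ev → ℝ≥0) (z : Ev) : ℝ≥0 :=
  densityFactor C θ l μ * f ((evEquiv hθ hl).symm z)

include hμ in
-- Needed to reindex the infimum over densities in `functional`.
theorem scaleDensity_surjective : Function.Surjective (scaleDensity (μ := μ) hθ hl C) := by
  intro f
  refine ⟨fun z => (densityFactor C θ l μ)⁻¹ * f (evEquiv hθ hl z), funext fun z => ?_⟩
  rw [scaleDensity, MeasurableEquiv.apply_symm_apply,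
    mul_inv_cancel_left₀ (densityFactor_pos hθ hl hμ C).ne']

include hμ in
theorem isDensity_scaleDensity_iff (T q : ℝ) (ρ : Measure ST) (f : Ev → ℝ≥0) :
    IsDensity (C.scale l) (T / θ) q (ENNReal.ofReal ((μ * θ)⁻¹) • ρ.map (sBar θ l))
      (scaleDensity (μ := μ) hθ hl C f) ↔ IsDensity C T q ρ f := by
  have hd := densityFactor_pos hθ hl hμ C
  refine and_congr ⟨fun h => ?_, fun h => ?_⟩ ?_
  · have h1 : ContinuousOn (fun z => (densityFactor C θ l μ)⁻¹ *
        scaleDensity (μ := μ) hθ hl C f (evEquiv hθ hl z)) (eventSet C T) :=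
      continuousOn_const.mul (h.comp (continuous_evEquiv hθ hl).continuousOn fun z hz =>
        (evEquiv_mem_eventSet hθ hl C T z).2 hz)
    refine h1.congr fun z _ => ?_
    simp only [scaleDensity, MeasurableEquiv.symm_apply_apply]
    rw [inv_mul_cancel_left₀ hd.ne']
  · refine continuousOn_const.mul
      (h.comp (continuous_evEquiv_symm hθ hl).continuousOn fun z hz => ?_)
    rw [← evEquiv_mem_eventSet hθ hl C T, MeasurableEquiv.apply_symm_apply]
    exact hz
  · have hr := refFactor_pos hθ hl C
    have hc : 0 < (μ * θ)⁻¹ := by positivity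
    have hfun : (fun z => ((scaleDensity (μ := μ) hθ hl C f z : ℝ≥0) : ℝ≥0∞)) ∘ evEquiv hθ hl =
        (densityFactor C θ l μ : ℝ≥0∞) • fun z => (f z : ℝ≥0∞) := by
      funext z
      simp [scaleDensity]
    rw [forwardQ_scale hθ hl, refMeasure_scale hθ hl, withDensity_smul_measure,
      map_withDensity_equiv, hfun, withDensity_smul' _ _ ENNReal.coe_ne_top, Measure.map_smul,
      smul_smul]
    rw [show ENNReal.ofReal (refFactor C θ l) * (densityFactor C θ l μ : ℝ≥0∞) =
        ENNReal.ofReal ((μ * θ)⁻¹) by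
      rw [show (densityFactor C θ l μ : ℝ≥0∞) =
        ENNReal.ofReal ((μ * θ)⁻¹ / refFactor C θ l) from rfl, ← ENNReal.ofReal_mul hr.le,
        mul_div_cancel₀ _ hr.ne']]
    -- Both sides now carry the same scalar and push-forward, and both operations are injective on
    -- measures.
    exact (smulMeasureEquiv (ofReal_ne_zero hc) ENNReal.ofReal_ne_top).injective.eq_iff.trans
      (mapMeasureEquiv (evEquiv hθ hl)).injective.eq_iff

theorem negLogIntegral_map (T : ℝ) (E : Measure Ev) (g : Ev → ℝ≥0∞) :
    negLogIntegral (eventSet (C.scale l) (T / θ)) (E.map (evEquiv hθ hl)) g =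
      negLogIntegral (eventSet C T) E (g ∘ evEquiv hθ hl) := by
  rw [negLogIntegral, negLogIntegral, (evEquiv hθ hl).restrict_map, evEquiv_preimage_eventSet,
    lintegral_map_equiv, lintegral_map_equiv]
  rfl

include hμ in
/-- Rescaling the problem changes the reconstruction functional by a finite constant which does not
depend on the state. -/
theorem exists_functional_rescale (q τ T : ℝ) {β : ℝ} (hβ : 0 < β) {E : Measure Ev}
    (hE : E univ < ⊤) :
    ∃ k : ℝ, ∀ y : State, functional (C.scale l) q (β * μ * (l ^ 2 / θ)) (τ / (μ * θ)) (T / θ)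
      (E.map (evEquiv hθ hl)) (y.rescale θ l μ) = functional C q β τ T E y + (k : EReal) := by
  -- The total factor inside the logarithm: `μθ` from the decay rate times the change of density.
  set κ : ℝ≥0∞ := ENNReal.ofReal (μ * θ) * densityFactor C θ l μ with hκ
  have h : 0 < μ * θ := mul_pos hμ hθ
  have h0 : κ ≠ 0 := mul_ne_zero (ofReal_ne_zero h)
    (ENNReal.coe_ne_zero.2 (densityFactor_pos hθ hl hμ C).ne')
  have ht : κ ≠ ⊤ := ENNReal.mul_ne_top ENNReal.ofReal_ne_top ENNReal.coe_ne_top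
  refine ⟨(ENNReal.ofReal (-(ENNReal.log κ).toReal) * E (eventSet C T)).toReal -
    (ENNReal.ofReal (ENNReal.log κ).toReal * E (eventSet C T)).toReal, fun y => ?_⟩
  have hA : decayRate (τ / (μ * θ)) * forward (C.scale l) (T / θ)
      ((y.rescale θ l μ).rho : Measure ST) univ =
      decayRate τ * forward C T (y.rho : Measure ST) univ := by
    have := congrArg (fun m : Measure Ev => m univ)
      (decayRate_smul_forward_scale (μ := μ) hθ hl hμ C τ T (y.rho : Measure ST))
    simpa only [← rescale_rho hμ, (evEquiv hθ hl).map_apply, preimage_univ, Measure.smul_apply,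
      smul_eq_mul] using this
  simp only [functional]
  rw [hA, mul_benamouBrenier_rescale hθ hl hμ hβ, ← iInf_add_coe]
  refine ((scaleDensity_surjective (μ := μ) hθ hl hμ C).iInf_congr _ fun f => ?_).symm
  rw [← iInf_add_coe]
  rw [rescale_rho hμ]
  refine iInf_congr_Prop (isDensity_scaleDensity_iff hθ hl hμ C T q _ f) fun hf => ?_
  have hfun : (fun z => decayRate (τ / (μ * θ)) *
      ((scaleDensity (μ := μ) hθ hl C f z : ℝ≥0) : ℝ≥0∞)) ∘ evEquiv hθ hl =
      fun z => κ * (decayRate τ * (f z : ℝ≥0∞)) := by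
    funext z
    simp only [Function.comp_apply, scaleDensity, MeasurableEquiv.symm_apply_apply,
      ENNReal.coe_mul, decayRate_scale h, hκ]
    ring
  have hg : AEMeasurable (fun z => decayRate τ * (f z : ℝ≥0∞)) (E.restrict (eventSet C T)) :=
    ((hf.1.aemeasurable (measurableSet_eventSet C T)).coe_nnreal_ennreal).const_mul _
  rw [negLogIntegral_map, hfun, negLogIntegral_const_mul hE h0 ht hg]
  abel

include hμ in
/-- The reconstruction is equivariant under rescaling. -/
theorem reconstruction_scale (q τ T : ℝ) {β : ℝ} (hβ : 0 < β) (E : PointMeasure Ev) :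
    reconstruction (C.scale l) q (β * μ * (l ^ 2 / θ)) (τ / (μ * θ)) (T / θ)
      (PointMeasure.mapEquiv (evEquiv hθ hl) E) =
      Hyperspace.image (State.rescale θ l μ) (reconstruction C q β τ T E) := by
  have huniv : (PointMeasure.mapEquiv (evEquiv hθ hl) E).1 univ = E.1 univ :=
    (evEquiv hθ hl).map_apply univ
  have hsurj := (rescaleHomeomorph hθ hl hμ).surjective
  have key : ∀ y, y.rescale θ l μ ∈ (reconstruction (C.scale l) q (β * μ * (l ^ 2 / θ))
      (τ / (μ * θ)) (T / θ) (PointMeasure.mapEquiv (evEquiv hθ hl) E)).carrier ↔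
      y ∈ (reconstruction C q β τ T E).carrier := by
    intro y
    change (PointMeasure.mapEquiv (evEquiv hθ hl) E).1 univ < ⊤ ∧ _ ↔ E.1 univ < ⊤ ∧ _
    rw [huniv]
    -- For infinite total count both reconstructions are empty; the finite shift is only available
    -- under `hE`.
    refine and_congr_right fun hE => and_congr (rescale_mem_stateSet_iff hθ hl hμ) ?_
    obtain ⟨k, hk⟩ := exists_functional_rescale hθ hl hμ C q τ T hβ hE
    have hk' : ∀ y : State, functional (C.scale l) q (β * μ * (l ^ 2 / θ)) (τ / (μ * θ)) (T / θ)
      (PointMeasure.mapEquiv (evEquiv hθ hl) E).1 (y.rescale θ l μ) =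
        functional C q β τ T E.1 y + (k : EReal) := hk
    -- Every competitor in the rescaled problem is a rescaled state, and the common constant `k`
    -- cancels.
    refine hsurj.forall.trans (forall_congr' fun y' => ?_)
    refine imp_congr (rescale_mem_stateSet_iff hθ hl hμ) ?_
    change functional _ _ _ _ _ _ _ ≤ functional _ _ _ _ _ _ (y'.rescale θ l μ) ↔ _
    rw [hk', hk', add_coe_le_add_coe_iff]
  ext z
  obtain ⟨y, rfl⟩ := hsurj z
  exact (key y).trans ((rescaleHomeomorph hθ hl hμ).injective.mem_set_image).symm

end Functional

end PET

/-! ### Equality of the laws of the reconstructions. -/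

theorem mainTheorem7 (C : PET.Scanner) (hC : C.Admissible)
    (q β τ T θ l μ : ℝ) (hq : 0 < q) (hβ : 0 < β) (hτ : 0 < τ) (hT : 0 < T)
    (hθ : 0 < θ) (hl : 0 < l) (hμ : 0 < μ)
    (ρ : FiniteMeasure PET.ST) (hρ : (ρ : Measure PET.ST) (Icc 0 T ×ˢ C.dom)ᶜ = 0)
    (hρt : PET.HasTimeSlices (ρ : Measure PET.ST))
    {Ω Ω' : Type*} [MeasurableSpace Ω] [MeasurableSpace Ω']
    (P : Measure Ω) (P' : Measure Ω') [IsProbabilityMeasure P] [IsProbabilityMeasure P']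
    (E : Ω → PET.PointMeasure PET.Ev) (E' : Ω' → PET.PointMeasure PET.Ev)
    (hE : PET.IsPoissonProcess E (PET.intensity C τ T ρ) P)
    (hE' : PET.IsPoissonProcess E'
      (PET.intensity (C.scale l) (τ / (μ * θ)) (T / θ) (PET.rescaleTruth θ l μ ρ)) P') :
    ((P'.map E').map
        (PET.reconstruction (C.scale l) q (β * μ * (l ^ 2 / θ)) (τ / (μ * θ)) (T / θ)) =
      ((P.map E).map (PET.reconstruction C q β τ T)).map
        (PET.Hyperspace.image (PET.State.rescale θ l μ))) ∧
    -- the same identity of laws, evaluated on each Borel set of the hyperspace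
    (∀ B : Set (PET.Hyperspace PET.State), MeasurableSet B →
      (P'.map E') {e | PET.reconstruction (C.scale l) q (β * μ * (l ^ 2 / θ)) (τ / (μ * θ))
          (T / θ) e ∈ B} =
        (P.map E) {e | PET.Hyperspace.image (PET.State.rescale θ l μ)
          (PET.reconstruction C q β τ T e) ∈ B}) := by
  have hlaw : P'.map E' = (P.map E).map (PET.PointMeasure.mapEquiv (PET.evEquiv hθ hl)) := by
    have hΛ : PET.intensity (C.scale l) (τ / (μ * θ)) (T / θ) (PET.rescaleTruth θ l μ ρ) =
        (PET.intensity C τ T ρ).map (PET.evEquiv hθ hl) := by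
      rw [PET.rescaleTruth_eq hμ]
      exact PET.decayRate_smul_forward_scale hθ hl hμ C τ T ρ
    rw [hΛ] at hE'
    rw [hE'.map_eq (hE.mapEquiv (PET.evEquiv hθ hl)),
      Measure.map_map (PET.PointMeasure.mapEquiv (PET.evEquiv hθ hl)).measurable hE.measurable]
    rfl
  have hrec := PET.reconstruction_scale hθ hl hμ C q τ T hβ
  constructor
  · rw [hlaw, PET.map_map_equiv_left]
    refine Eq.trans ?_ (PET.map_map_equiv_right
      (PET.Hyperspace.imageEquiv (PET.rescaleHomeomorph hθ hl hμ)) _ _).symm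
    exact congrArg (fun f => (P.map E).map f) (funext hrec)
  -- The first identity would be vacuous if the reconstruction were not a.e. measurable, so
  -- preimages are compared directly; a measurable equivalence evaluates its push-forward on
  -- arbitrary sets.
  · intro B _
    rw [hlaw, MeasurableEquiv.map_apply]
    refine congrArg (P.map E) (ext fun e => ?_)
    exact Eq.to_iff (congrArg (· ∈ B) (hrec e))
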